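/- Let $\mathcal A$ be a von Neumann algebra with a normal faithful tracial state $\tau$. Free cumulants $R_k$ with respect to $\tau$ are defined by the moment–cumulant formula $\tau(Y_1\cdots Y_n)=\sum_{\nu\in NC(n)}\prod_{B\in\nu}R_{|B|}(Y_i:i\in B)$ over non-crossing partitions, and a family of elements is free if all mixed free cumulants vanish. Let $(X_t)_{t\ge 0}$ be a free Lévy process in $\mathcal A$, i.e. the $X_t\in\mathcal A$ are self-adjoint (bounded), $X_0=0$, the increments over successive time intervals are free, and the distribution of $X_{s+t}-X_s$ depends only on $t$. Suppose that $\tau(X_t)=0$ and $\tau(X_t^2)=t$ for all $t>0$. For $a\in\mathbb R$ and $b\ge -1$ let $\mu_{a,b}$ be the free Meixner law, i.e. the compactly supported probability measure on $\mathbb R$ with Cauchy–Stieltjes transform $$G(z)=\int_{\mathbb R}\frac{\mu_{a,b}(dy)}{z-y}=\frac{(1+2b)z+a-\sqrt{(z-a)^2-4(1+b)}}{2(bz^2+az+1)},\qquad \operatorname{Im} z>0,$$ where the branch of the analytic square root is such that $\operatorname{Im}G(z)\le 0$ (at zeros of the denominator the quotient is understood by analytic continuation). The law of a self-adjoint $Y\in\mathcal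 A$ is the compactly supported probability measure $\mu$ on $\mathbb R$ with $\tau(Y^n)=\int y^n\,\mu(dy)$ for all $n\ge 0$. Let $\tau(\cdot\,|\,Y)$ denote the $\tau$-preserving conditional expectation onto the von Neumann algebra generated by $Y$ and the identity $\mathbb I$. Let $a\in\mathbb R$ and $b\ge 0$. Then the following are equivalent: 1. for all $t,s>0$ the normalized increment $(X_{t+s}-X_t)/\sqrt s$ has the free Meixner law $\mu_{a/\sqrt s,\,b/s}$; 2. for all $0\le t<s$, $$\tau(X_tX_sX_t\,|\,X_s)=\frac{(s-t)t}{s^2(b+s)^2}\Big(b^2X_s^3+2ab\,s\,X_s^2+(b+a^2)s^2X_s+a s^3\,\mathbb I\Big)+\frac{t^2}{s^2}X_s^3 .$$ -/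

import Mathlib

open scoped NNReal ComplexOrder InnerProductSpace

/-! ### Free cumulants and freeness -/

section FreeProbability

variable {A : Type*} [Ring A] [Algebra ℂ A]

/-- A partition `π` of `{0, …, n-1}` is non-crossing if there are no `i < j < k < l` such that
`i, k` lie in one block and `j, l` lie in a different block. -/
def IsNonCrossing {n : ℕ} (π : Finpartition (Finset.univ : Finset (Fin n))) : Prop :=
  ∀ B ∈ π.parts, ∀ C ∈ π.parts, B ≠ C →
    ∀ i j k l : Fin n, i < j → j < k → k < l → i ∈ B → k ∈ B → j ∈ C → l ∈ C → False

open Classical in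
/-- The set `NC(n)` of all non-crossing partitions of `{0, …, n-1}`. -/
noncomputable def NC (n : ℕ) : Finset (Finpartition (Finset.univ : Finset (Fin n))) :=
  Finset.univ.filter IsNonCrossing

open Classical in
/-- The free cumulants `R_n(x_1, …, x_n)` of a linear functional `τ`, defined by solving the
moment-cumulant formula `τ(x_1 ⋯ x_n) = ∑_{π ∈ NC(n)} ∏_{B ∈ π} R_{|B|}(x_i : i ∈ B)` for the term
of the one-block partition. All blocks occurring in the sum below have fewer than `n` elements, so
the `else` branch is never reached; see `moment_eq_sum_freeCumulant`. -/
noncomputable def freeCumulant (τ : A →ₗ[ℂ] ℂ) (n : ℕ) (x : Fin n → A) : ℂ :=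
  τ (List.ofFn x).prod -
    ∑ π ∈ (NC n).filter (fun π => Finset.univ ∉ π.parts), ∏ B ∈ π.parts,
      if _h : B.card < n then freeCumulant τ B.card (fun i => x (B.orderEmbOfFin rfl i)) else 1
termination_by n

/-- The moment-cumulant formula, which characterizes the free cumulants. -/
theorem moment_eq_sum_freeCumulant (τ : A →ₗ[ℂ] ℂ) (n : ℕ) (hn : 0 < n) (x : Fin n → A) :
    τ (List.ofFn x).prod =
      ∑ π ∈ NC n, ∏ B ∈ π.parts, freeCumulant τ B.card (fun i => x (B.orderEmbOfFin rfl i)) := by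
  have : NeZero n := ⟨hn.ne'⟩
  have hne : (Finset.univ : Finset (Fin n)) ≠ ⊥ := Finset.univ_nonempty.ne_empty
  set F : Finpartition (Finset.univ : Finset (Fin n)) → ℂ := fun π =>
    ∏ B ∈ π.parts, freeCumulant τ B.card (fun i => x (B.orderEmbOfFin rfl i)) with hF
  have huniq : ∀ π : Finpartition (Finset.univ : Finset (Fin n)), Finset.univ ∈ π.parts →
      π.parts = {Finset.univ} := by
    intro π hπ
    refine Finset.eq_singleton_iff_unique_mem.2 ⟨hπ, fun B hB => ?_⟩
    obtain ⟨i, hi⟩ := π.nonempty_of_mem_parts hB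
    exact π.eq_of_mem_parts hB hπ hi (Finset.mem_univ i)
  have hone : (NC n).filter (fun π => ¬ Finset.univ ∉ π.parts) = {Finpartition.indiscrete hne} := by
    ext π
    simp only [NC, Finset.mem_filter, Finset.mem_univ, true_and, not_not, Finset.mem_singleton]
    constructor
    · rintro ⟨-, h⟩
      exact Finpartition.ext (huniq π h)
    · rintro rfl
      refine ⟨?_, by simp⟩
      intro B hB C hC hBC
      simp only [Finpartition.indiscrete_parts, Finset.mem_singleton] at hB hC
      exact absurd (hB.trans hC.symm) hBC
  have hemb : (fun i => x ((Finset.univ : Finset (Fin n)).orderEmbOfFin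
      (Finset.card_fin n) i)) = x := by
    funext i
    have := Finset.orderEmbOfFin_unique (Finset.card_fin n) (f := (id : Fin n → Fin n))
      (fun _ => Finset.mem_univ _) strictMono_id
    rw [← this]; rfl
  have hcast : ∀ (m : ℕ) (h : (Finset.univ : Finset (Fin n)).card = m),
      freeCumulant τ (Finset.univ : Finset (Fin n)).card
        (fun i => x (Finset.univ.orderEmbOfFin rfl i)) =
      freeCumulant τ m (fun i => x (Finset.univ.orderEmbOfFin h i)) := by
    intro m h; subst h; rfl
  have hFone : F (Finpartition.indiscrete hne) = freeCumulant τ n x := by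
    simp only [hF, Finpartition.indiscrete_parts, Finset.prod_singleton]
    rw [hcast n (Finset.card_fin n), hemb]
  change _ = ∑ π ∈ NC n, F π
  rw [← Finset.sum_filter_add_sum_filter_not (NC n) (fun π => Finset.univ ∉ π.parts), hone,
    Finset.sum_singleton, hFone, freeCumulant]
  have : ∀ π ∈ (NC n).filter (fun π => Finset.univ ∉ π.parts),
      (∏ B ∈ π.parts, if _h : B.card < n then
        freeCumulant τ B.card (fun i => x (B.orderEmbOfFin rfl i)) else 1) = F π := by
    intro π hπ
    refine Finset.prod_congr rfl fun B hB => dif_pos ?_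
    rw [Finset.mem_filter] at hπ
    have : B ≠ Finset.univ := fun h => hπ.2 (h ▸ hB)
    simpa using Finset.card_lt_card (Finset.ssubset_univ_iff.2 this)
  rw [Finset.sum_congr rfl this]
  ring

/-- The elements `x i` are freely independent with respect to `τ`: all mixed free cumulants
vanish. -/
def FreelyIndependent (τ : A →ₗ[ℂ] ℂ) {ι : Type*} (x : ι → A) : Prop :=
  ∀ (k : ℕ) (i : Fin k → ι), (∃ p q, i p ≠ i q) → freeCumulant τ k (fun p => x (i p)) = 0

/-- Two (self-adjoint, bounded) elements have the same distribution: the same moments. -/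
def SameDistribution (τ : A →ₗ[ℂ] ℂ) (x y : A) : Prop :=
  ∀ n : ℕ, τ (x ^ n) = τ (y ^ n)

/-- A (bounded) free Lévy process: a family of self-adjoint elements, started at `0`, with freely
independent and stationary increments. (Continuity in law is not listed: it is automatic as soon as
`τ (X t ^ 2) = t`.) -/
structure IsFreeLevyProcess [StarRing A] (τ : A →ₗ[ℂ] ℂ) (X : ℝ≥0 → A) : Prop where
  selfAdjoint : ∀ t, IsSelfAdjoint (X t)
  zero : X 0 = 0
  free_increments : ∀ (n : ℕ) (t : Fin (n + 1) → ℝ≥0), StrictMono t →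
    FreelyIndependent τ (fun i : Fin n => X (t i.succ) - X (t i.castSucc))
  stationary : ∀ s s' t, SameDistribution τ (X (s + t) - X s) (X (s' + t) - X s')

end FreeProbability

/-! ### Laws, and the free Meixner laws -/

section Laws

open MeasureTheory

/-- A compactly supported probability measure on the real line. -/
def IsCompactlySupportedProbability (μ : Measure ℝ) : Prop :=
  IsProbabilityMeasure μ ∧ ∃ r : ℝ, μ (Set.Icc (-r) r)ᶜ = 0

/-- `μ` is the law of the self-adjoint element `x`: the compactly supported probability measure on
`ℝ` with the same moments as `x`. -/
def IsLawOf {A : Type*} [Ring A] [Algebra ℂ A] (τ : A →ₗ[ℂ] ℂ) (x : A) (μ : Measure ℝ) : Prop :=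
  IsCompactlySupportedProbability μ ∧ ∀ n : ℕ, τ (x ^ n) = ((∫ y, y ^ n ∂μ : ℝ) : ℂ)

/-- The Cauchy-Stieltjes transform `G_μ(z) = ∫ 1 / (z - y) μ(dy)`. -/
noncomputable def cauchyTransform (μ : Measure ℝ) (z : ℂ) : ℂ :=
  ∫ y : ℝ, 1 / (z - (y : ℂ)) ∂μ

/-- `μ` is the free Meixner law `μ_{a,b}`: the compactly supported probability measure whose
Cauchy-Stieltjes transform on the upper half plane is
`G(z) = ((1 + 2b) z + a - √((z - a)² - 4 (1 + b))) / (2 (b z² + a z + 1))`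
for an analytic branch `w` of the square root with `Im G ≤ 0`. The denominator is multiplied out,
because it may have (removable) zeros in the upper half plane. -/
def IsFreeMeixnerLaw (a b : ℝ) (μ : Measure ℝ) : Prop :=
  IsCompactlySupportedProbability μ ∧
    ∃ w : ℂ → ℂ, DifferentiableOn ℂ w {z | 0 < z.im} ∧
      ∀ z : ℂ, 0 < z.im →
        w z ^ 2 = (z - a) ^ 2 - 4 * (1 + b) ∧
        2 * (b * z ^ 2 + a * z + 1) * cauchyTransform μ z = (1 + 2 * b) * z + a - w z ∧
        (cauchyTransform μ z).im ≤ 0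

/-- The element `x` has the free Meixner law `μ_{a,b}`. -/
def HasFreeMeixnerLaw {A : Type*} [Ring A] [Algebra ℂ A] (τ : A →ₗ[ℂ] ℂ) (x : A) (a b : ℝ) :
    Prop :=
  ∃ μ : Measure ℝ, IsLawOf τ x μ ∧ IsFreeMeixnerLaw a b μ

end Laws

/-! ### Tracial von Neumann algebras and conditional expectations -/

section VonNeumann

variable {H : Type*} [NormedAddCommGroup H] [InnerProductSpace ℂ H] [CompleteSpace H]

/-- `τ` is a normal faithful tracial state on the von Neumann algebra `M`. Normality (weak-*, that
is ultraweak, continuity) is expressed by `τ(x) = ∑ₙ ⟪ξₙ, x ηₙ⟫` with square-summable `ξ`, `η`. -/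
structure IsNormalFaithfulTracialState (M : VonNeumannAlgebra H)
    (τ : M.toStarSubalgebra →ₗ[ℂ] ℂ) : Prop where
  map_one : τ 1 = 1
  tracial : ∀ x y, τ (x * y) = τ (y * x)
  nonneg : ∀ x, 0 ≤ τ (x * star x)
  faithful : ∀ x, τ (x * star x) = 0 → x = 0
  normal : ∃ ξ η : ℕ → H, Summable (fun n => ‖ξ n‖ ^ 2) ∧ Summable (fun n => ‖η n‖ ^ 2) ∧
    ∀ x : M.toStarSubalgebra,
      HasSum (fun n => ⟪ξ n, (x : H →L[ℂ] H) (η n)⟫_ℂ) (τ x)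

/-- The von Neumann algebra generated by a set `S` of bounded operators (and the identity): the
double commutant of `S ∪ S*`. It is the smallest one containing `S`, see
`subset_vonNeumannGenerated` and `vonNeumannGenerated_le`. -/
noncomputable def vonNeumannGenerated (S : Set (H →L[ℂ] H)) : VonNeumannAlgebra H where
  toStarSubalgebra :=
    StarSubalgebra.centralizer ℂ (StarSubalgebra.centralizer ℂ S : Set (H →L[ℂ] H))
  centralizer_centralizer' := by
    change Set.centralizer (Set.centralizer (StarSubalgebra.centralizer ℂ
      (StarSubalgebra.centralizer ℂ S : Set (H →L[ℂ] H)) : Set (H →L[ℂ] H))) = _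
    rw [StarSubalgebra.coe_centralizer_centralizer, Set.centralizer_centralizer_centralizer]
    exact (StarSubalgebra.coe_centralizer_centralizer ℂ S).symm

theorem subset_vonNeumannGenerated (S : Set (H →L[ℂ] H)) :
    S ⊆ (vonNeumannGenerated S : Set (H →L[ℂ] H)) := by
  have h : (vonNeumannGenerated S : Set (H →L[ℂ] H)) = Set.centralizer (S ∪ star S).centralizer :=
    StarSubalgebra.coe_centralizer_centralizer ℂ S
  rw [h]
  exact Set.subset_union_left.trans Set.subset_centralizer_centralizer

theorem vonNeumannGenerated_le (S : Set (H →L[ℂ] H)) (N : VonNeumannAlgebra H)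
    (hS : S ⊆ (N : Set (H →L[ℂ] H))) : vonNeumannGenerated S ≤ N := by
  have h : (vonNeumannGenerated S : Set (H →L[ℂ] H)) = Set.centralizer (S ∪ star S).centralizer :=
    StarSubalgebra.coe_centralizer_centralizer ℂ S
  have hS' : S ∪ star S ⊆ (N : Set (H →L[ℂ] H)) := by
    refine Set.union_subset hS fun x hx => ?_
    have := star_mem (S := VonNeumannAlgebra H) (hS hx)
    simpa using this
  change (vonNeumannGenerated S : Set (H →L[ℂ] H)) ⊆ (N : Set (H →L[ℂ] H))
  rw [h, ← N.centralizer_centralizer]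
  exact Set.centralizer_subset (Set.centralizer_subset hS')

/-- For a von Neumann subalgebra `B` of `M`, `W` is the conditional expectation `τ(U | B)`:
it lies in `B` and satisfies `τ(U Y) = τ(W Y)` for all `Y ∈ B`. -/
def IsCondExp {M : VonNeumannAlgebra H} (τ : M.toStarSubalgebra →ₗ[ℂ] ℂ) (B : VonNeumannAlgebra H)
    (U W : M.toStarSubalgebra) : Prop :=
  (W : H →L[ℂ] H) ∈ B ∧
    ∀ Y : M.toStarSubalgebra, (Y : H →L[ℂ] H) ∈ B → τ (U * Y) = τ (W * Y)

/-- The conditional expectation is unique. -/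
theorem IsCondExp.unique {M : VonNeumannAlgebra H} {τ : M.toStarSubalgebra →ₗ[ℂ] ℂ}
    (hτ : IsNormalFaithfulTracialState M τ) {B : VonNeumannAlgebra H}
    {U W W' : M.toStarSubalgebra} (h : IsCondExp τ B U W) (h' : IsCondExp τ B U W') : W = W' := by
  rw [← sub_eq_zero]
  refine hτ.faithful _ ?_
  have hmem : ((star (W - W') : M.toStarSubalgebra) : H →L[ℂ] H) ∈ B :=
    star_mem (sub_mem h.1 h'.1)
  rw [sub_mul, map_sub, ← h.2 _ hmem, ← h'.2 _ hmem, sub_self]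

/-- `W = τ(U | V)`: conditional expectation onto the von Neumann algebra generated by `V`
and the identity. -/
def IsCondExpGiven {M : VonNeumannAlgebra H} (τ : M.toStarSubalgebra →ₗ[ℂ] ℂ)
    (U V W : M.toStarSubalgebra) : Prop :=
  IsCondExp τ (vonNeumannGenerated {(V : H →L[ℂ] H)}) U W

end VonNeumann

/-! Both conditions say that the moment generating series M of X_s solves one quadratic equation,
b(M - 1)² + a s X M(M - 1) + s² X² M² = s(M - 1), which is `IsMeixnerSeries`.

For the laws, put z = 1/x and G(z) = x M(x): after scaling to variance one this is the quadratic
equation that has the stated G as a root. Its formal version and its version on the upper half plane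
are equivalent by the identity theorem (`isFreeMeixnerLaw_iff`).

For the regression, normality of τ allows the conditional expectation to be tested on the powers of
X_s alone (`isCondExpGiven_iff`). Suppose that the free cumulants of X_t are l = t/s times those c_k
of X_s. In the expansion of τ(X_t X_s X_t X_sⁿ) over non-crossing partitions, every block through
the first or third position gets a factor l: a partition gets l if these positions share a block, l²
otherwise. As the mean is zero, sharing a block forces the second position into it. So the moment is
l² m_{n+3} + l(1 - l) w_n, where w_n sums over the partitions that join the first three points
(`FreelyIndependent.moment_triple`), and the regression formula is a linear relation between w_n and
the moments. Following a block from one element to the next gives W_j = c_j M + X M W_{j+1} for the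
series W_j of partitions that join the first j points. This expresses W_3 by M, and M² X³ times the
relation factors as the quadratic equation times a series with constant term 2b + s ≠ 0
(`ncWeight_three_iff_isMeixnerSeries`).

It remains to justify proportionality of the cumulants. If all the laws are Meixner, the quadratic
equation yields a cumulant recursion that is homogeneous in s
(`IsMeixnerSeries.cumulants_proportional`). In the converse direction t = s/2 suffices, where
freeness and stationarity give it directly (`IsFreeLevyProcess.freeCumulant_half`). -/

/-! ### Weighted sums over non-crossing partitions and their recursion. -/

section NonCrossingSums

variable {α : Type*} [LinearOrder α]

/-- `π` is the set of blocks of a non-crossing partition of the finite set `S`. -/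
structure IsNCPartition (S : Finset α) (π : Finset (Finset α)) : Prop where
  nonempty : ∀ B ∈ π, B.Nonempty
  subset : ∀ B ∈ π, B ⊆ S
  cover : ∀ i ∈ S, ∃ B ∈ π, i ∈ B
  eq_of_mem : ∀ B ∈ π, ∀ C ∈ π, ∀ i, i ∈ B → i ∈ C → B = C
  noncrossing : ∀ B ∈ π, ∀ C ∈ π, ∀ i j k l, i < j → j < k → k < l →
    i ∈ B → k ∈ B → j ∈ C → l ∈ C → B = C

open Classical in
/-- The non-crossing partitions of a finite set, as sets of blocks. -/
noncomputable def ncPartitions (S : Finset α) : Finset (Finset (Finset α)) :=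
  S.powerset.powerset.filter (IsNCPartition S)

theorem mem_ncPartitions {S : Finset α} {π : Finset (Finset α)} :
    π ∈ ncPartitions S ↔ IsNCPartition S π := by
  simp only [ncPartitions, Finset.mem_filter, Finset.mem_powerset, and_iff_right_iff_imp]
  exact fun h B hB => Finset.mem_powerset.2 (h.subset B hB)

variable {R : Type*} [CommRing R] (c : ℕ → R)

/-- The sum over the non-crossing partitions of `S` of the product of the weights `c |B|` of the
blocks. -/
noncomputable def ncSum (S : Finset α) : R :=
  ∑ π ∈ ncPartitions S, ∏ B ∈ π, c B.card

open Classical in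
/-- The part of `ncSum c S` that comes from the partitions with `T` inside one block. -/
noncomputable def ncSumJoined (S T : Finset α) : R :=
  ∑ π ∈ (ncPartitions S).filter (fun π => ∃ B ∈ π, T ⊆ B), ∏ B ∈ π, c B.card

/-- Two partitions of complementary pieces, one of them order-convex, form a partition. -/
theorem IsNCPartition.union {S G : Finset α} {π ρ : Finset (Finset α)} (hGS : G ⊆ S)
    (hG : ∀ i ∈ G, ∀ k ∈ G, ∀ j ∈ S, i < j → j < k → j ∈ G)
    (hπ : IsNCPartition G π) (hρ : IsNCPartition (S \ G) ρ) : IsNCPartition S (π ∪ ρ) where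
  nonempty B hB := (Finset.mem_union.1 hB).elim (hπ.nonempty B) (hρ.nonempty B)
  subset B hB := (Finset.mem_union.1 hB).elim (fun h => (hπ.subset B h).trans hGS)
    (fun h => (hρ.subset B h).trans Finset.sdiff_subset)
  cover i hi := by
    by_cases h : i ∈ G
    · obtain ⟨B, hB, hiB⟩ := hπ.cover i h
      exact ⟨B, Finset.mem_union_left _ hB, hiB⟩
    · obtain ⟨B, hB, hiB⟩ := hρ.cover i (Finset.mem_sdiff.2 ⟨hi, h⟩)
      exact ⟨B, Finset.mem_union_right _ hB, hiB⟩
  eq_of_mem B hB C hC i hiB hiC := by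
    rcases Finset.mem_union.1 hB with hB | hB <;> rcases Finset.mem_union.1 hC with hC | hC
    · exact hπ.eq_of_mem B hB C hC i hiB hiC
    · exact absurd (hπ.subset B hB hiB) (Finset.mem_sdiff.1 (hρ.subset C hC hiC)).2
    · exact absurd (hπ.subset C hC hiC) (Finset.mem_sdiff.1 (hρ.subset B hB hiB)).2
    · exact hρ.eq_of_mem B hB C hC i hiB hiC
  noncrossing B hB C hC i j k l hij hjk hkl hi hk hj hl := by
    rcases Finset.mem_union.1 hB with hB | hB <;> rcases Finset.mem_union.1 hC with hC | hC
    · exact hπ.noncrossing B hB C hC i j k l hij hjk hkl hi hk hj hl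
    -- A block in `G` cannot cross a block outside: one of the two middle points would be an outside
    -- point between two points of `G`.
    · have hjC := Finset.mem_sdiff.1 (hρ.subset C hC hj)
      exact absurd (hG i (hπ.subset B hB hi) k (hπ.subset B hB hk) j hjC.1 hij hjk) hjC.2
    · have hkB := Finset.mem_sdiff.1 (hρ.subset B hB hk)
      exact absurd (hG j (hπ.subset C hC hj) l (hπ.subset C hC hl) k hkB.1 hjk hkl) hkB.2
    · exact hρ.noncrossing B hB C hC i j k l hij hjk hkl hi hk hj hl

theorem IsNCPartition.of_subset {S S' : Finset α} {π ρ : Finset (Finset α)}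
    (hπ : IsNCPartition S π) (hρ : ρ ⊆ π) (hsub : ∀ B ∈ ρ, B ⊆ S')
    (hcov : ∀ i ∈ S', ∃ B ∈ ρ, i ∈ B) : IsNCPartition S' ρ where
  nonempty B hB := hπ.nonempty B (hρ hB)
  subset := hsub
  cover := hcov
  eq_of_mem B hB C hC := hπ.eq_of_mem B (hρ hB) C (hρ hC)
  noncrossing B hB C hC := hπ.noncrossing B (hρ hB) C (hρ hC)

open Classical in
/-- The partitions for which an order-convex set `G` is a union of blocks. -/
theorem sum_ncPartitions_split {S G T : Finset α} (hGS : G ⊆ S)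
    (hG : ∀ i ∈ G, ∀ k ∈ G, ∀ j ∈ S, i < j → j < k → j ∈ G)
    (hT : T ⊆ S \ G) (hT0 : T.Nonempty) :
    ∑ π ∈ (ncPartitions S).filter
        (fun π => (∀ B ∈ π, B ⊆ G ∨ Disjoint B G) ∧ ∃ B ∈ π, T ⊆ B), ∏ B ∈ π, c B.card =
      ncSum c G * ncSumJoined c (S \ G) T := by
  obtain ⟨t, ht⟩ := hT0
  have hnot : ∀ {ρ : Finset (Finset α)}, IsNCPartition (S \ G) ρ → ∀ B ∈ ρ, ¬ B ⊆ G := by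
    intro ρ hρ B hB hBG
    obtain ⟨i, hi⟩ := hρ.nonempty B hB
    exact (Finset.mem_sdiff.1 (hρ.subset B hB hi)).2 (hBG hi)
  rw [ncSum, ncSumJoined, Finset.sum_mul_sum, ← Finset.sum_product']
  refine Finset.sum_bij' (fun π _ => (π.filter (· ⊆ G), π.filter (¬ · ⊆ G)))
    (fun p _ => p.1 ∪ p.2) ?_ ?_ ?_ ?_ ?_
  · intro π hπ
    obtain ⟨hπ, hsep, B, hB, hTB⟩ := Finset.mem_filter.1 hπ
    rw [mem_ncPartitions] at hπ
    simp only [Finset.mem_product, Finset.mem_filter, mem_ncPartitions]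
    refine ⟨hπ.of_subset (Finset.filter_subset _ _) (fun C hC => (Finset.mem_filter.1 hC).2) ?_,
      hπ.of_subset (Finset.filter_subset _ _) ?_ ?_, B, ⟨hB, ?_⟩, hTB⟩
    · intro i hi
      obtain ⟨C, hC, hiC⟩ := hπ.cover i (hGS hi)
      refine ⟨C, Finset.mem_filter.2 ⟨hC, ?_⟩, hiC⟩
      exact (hsep C hC).resolve_right fun h => Finset.disjoint_left.1 h hiC hi
    · intro C hC
      obtain ⟨hC, hCG⟩ := Finset.mem_filter.1 hC
      exact Finset.subset_sdiff.2 ⟨hπ.subset C hC, (hsep C hC).resolve_left hCG⟩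
    · intro i hi
      obtain ⟨hi, hiG⟩ := Finset.mem_sdiff.1 hi
      obtain ⟨C, hC, hiC⟩ := hπ.cover i hi
      exact ⟨C, Finset.mem_filter.2 ⟨hC, fun h => hiG (h hiC)⟩, hiC⟩
    · exact fun h => (Finset.mem_sdiff.1 (hT ht)).2 (h (hTB ht))
  · rintro ⟨π, ρ⟩ hp
    simp only [Finset.mem_product, Finset.mem_filter, mem_ncPartitions] at hp ⊢
    obtain ⟨hπ, hρ, B, hB, hTB⟩ := hp
    refine ⟨hπ.union hGS hG hρ, fun C hC => ?_, B, Finset.mem_union_right _ hB, hTB⟩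
    rcases Finset.mem_union.1 hC with hC | hC
    · exact Or.inl (hπ.subset C hC)
    · exact Or.inr (Finset.subset_sdiff.1 (hρ.subset C hC)).2
  · intro π _
    exact Finset.filter_union_filter_not_eq _ π
  · rintro ⟨π, ρ⟩ hp
    simp only [Finset.mem_product, Finset.mem_filter, mem_ncPartitions] at hp
    obtain ⟨hπ, hρ, -⟩ := hp
    have h1 : π.filter (· ⊆ G) = π := Finset.filter_true_of_mem hπ.subset
    have h2 : ρ.filter (· ⊆ G) = ∅ := Finset.filter_false_of_mem (hnot hρ)
    have h3 : π.filter (¬ · ⊆ G) = ∅ :=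
      Finset.filter_false_of_mem fun B hB h => h (hπ.subset B hB)
    have h4 : ρ.filter (¬ · ⊆ G) = ρ := Finset.filter_true_of_mem (hnot hρ)
    simp only [Finset.filter_union, h1, h2, h3, h4, Finset.union_empty, Finset.empty_union]
  · intro π _
    exact (Finset.prod_filter_mul_prod_filter_not π _ _).symm

theorem ncPartitions_empty : ncPartitions (∅ : Finset α) = {∅} := by
  ext π
  rw [mem_ncPartitions, Finset.mem_singleton]
  constructor
  · intro h
    refine Finset.eq_empty_of_forall_notMem fun B hB => ?_
    obtain ⟨i, hi⟩ := h.nonempty B hB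
    exact absurd (h.subset B hB hi) (Finset.notMem_empty i)
  · rintro rfl
    constructor <;> simp

theorem ncSum_empty : ncSum c (∅ : Finset α) = 1 := by
  simp [ncSum, ncPartitions_empty]

theorem ncSum_eq_joined (S : Finset α) (hS : S.Nonempty) :
    ncSum c S = ncSumJoined c S {S.min' hS} := by
  classical
  rw [ncSum, ncSumJoined, Finset.filter_true_of_mem]
  intro π hπ
  obtain ⟨B, hB, hi⟩ := (mem_ncPartitions.1 hπ).cover _ (S.min'_mem hS)
  exact ⟨B, hB, Finset.singleton_subset_iff.2 hi⟩

theorem ncSumJoined_self (T : Finset α) (hT : T.Nonempty) : ncSumJoined c T T = c T.card := by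
  classical
  have : (ncPartitions T).filter (fun π => ∃ B ∈ π, T ⊆ B) = {{T}} := by
    ext π
    simp only [Finset.mem_filter, mem_ncPartitions, Finset.mem_singleton]
    constructor
    · rintro ⟨hπ, B, hB, hTB⟩
      obtain rfl : B = T := (hπ.subset B hB).antisymm hTB
      refine Finset.eq_singleton_iff_unique_mem.2 ⟨hB, fun C hC => ?_⟩
      obtain ⟨i, hi⟩ := hπ.nonempty C hC
      exact hπ.eq_of_mem C hC B hB i hi (hπ.subset C hC hi)
    · rintro rfl
      refine ⟨⟨?_, ?_, ?_, ?_, ?_⟩, T, Finset.mem_singleton_self _, subset_rfl⟩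
      · simpa using hT
      · simp
      · simp
      · simp +contextual
      · simp +contextual
  rw [ncSumJoined, this, Finset.sum_singleton, Finset.prod_singleton]

/-- Split according to the element that follows the initial segment `T` in its block. -/
theorem ncSumJoined_eq {S T : Finset α} (hTS : T ⊆ S) (hT0 : T.Nonempty)
    (hT : ∀ i ∈ T, ∀ j ∈ S \ T, i < j) :
    ncSumJoined c S T = c T.card * ncSum c (S \ T) +
      ∑ q ∈ S \ T, ncSum c ((S \ T).filter (· < q)) *
        ncSumJoined c (S \ (S \ T).filter (· < q)) (insert q T) := by
  classical
  -- Case where `T` is itself a block: equivalently, its complement is a union of blocks.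
  have hA : c T.card * ncSum c (S \ T) = ∑ π ∈ (ncPartitions S).filter
      (fun π => (∀ B ∈ π, B ⊆ S \ T ∨ Disjoint B (S \ T)) ∧ ∃ B ∈ π, T ⊆ B),
        ∏ B ∈ π, c B.card := by
    have hST : S \ (S \ T) = T := Finset.sdiff_sdiff_eq_self hTS
    rw [sum_ncPartitions_split c Finset.sdiff_subset ?_ (by rw [hST]) hT0, hST,
      ncSumJoined_self c T hT0, mul_comm]
    intro i hi k hk j hj hij hjk
    by_contra h
    have hjT : j ∈ T := by by_contra h'; exact h (Finset.mem_sdiff.2 ⟨hj, h'⟩)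
    exact lt_asymm hij (hT j hjT i hi)
  -- Case where `q` follows `T` in its block: by non-crossing, the gap between `T` and `q` is a
  -- union of blocks. Once the gap is removed, `insert q T` is again an initial segment.
  have hQ : ∀ q ∈ S \ T, ncSum c ((S \ T).filter (· < q)) *
        ncSumJoined c (S \ (S \ T).filter (· < q)) (insert q T) =
      ∑ π ∈ (ncPartitions S).filter (fun π =>
        (∀ B ∈ π, B ⊆ (S \ T).filter (· < q) ∨ Disjoint B ((S \ T).filter (· < q))) ∧
          ∃ B ∈ π, insert q T ⊆ B), ∏ B ∈ π, c B.card := by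
    intro q hq
    refine (sum_ncPartitions_split c ((Finset.filter_subset _ _).trans Finset.sdiff_subset) ?_ ?_
      (Finset.insert_nonempty _ _)).symm
    · intro i hi k hk j hj hij hjk
      simp only [Finset.mem_filter] at hi hk ⊢
      refine ⟨Finset.mem_sdiff.2 ⟨hj, fun hjT => lt_asymm hij (hT j hjT i hi.1)⟩, hjk.trans hk.2⟩
    · intro i hi
      rcases Finset.mem_insert.1 hi with rfl | hi
      · simp [(Finset.mem_sdiff.1 hq).1]
      · simp [hi, hTS hi]
  rw [hA, Finset.sum_congr rfl hQ, ncSumJoined]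
  simp only [Finset.sum_filter]
  rw [Finset.sum_comm, ← Finset.sum_add_distrib]
  refine Finset.sum_congr rfl fun π hπ => ?_
  rw [mem_ncPartitions] at hπ
  obtain ⟨t, ht⟩ := hT0
  by_cases hJ : ∃ B ∈ π, T ⊆ B
  swap
  · have h2 : ∀ q, ¬ ∃ B ∈ π, insert q T ⊆ B := fun q ⟨B, hB, h⟩ =>
      hJ ⟨B, hB, (Finset.subset_insert _ _).trans h⟩
    simp [hJ, h2]
  obtain ⟨B, hB, hTB⟩ := hJ
  have huniq : ∀ C ∈ π, ∀ T', t ∈ T' → T' ⊆ C → C = B := fun C hC T' htT' h =>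
    hπ.eq_of_mem C hC B hB t (h htT') (hTB ht)
  rw [if_pos ⟨B, hB, hTB⟩]
  by_cases hBT : B = T
  · subst hBT
    rw [if_pos, Finset.sum_eq_zero, add_zero]
    · intro q hq
      rw [if_neg]
      rintro ⟨-, C, hC, h⟩
      have := huniq C hC _ (Finset.mem_insert_of_mem ht) h
      subst this
      exact (Finset.mem_sdiff.1 hq).2 (h (Finset.mem_insert_self _ _))
    · refine ⟨fun C hC => ?_, B, hB, hTB⟩
      by_cases hCB : C = B
      · right; rw [hCB]; exact Finset.disjoint_sdiff
      · left
        intro i hi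
        refine Finset.mem_sdiff.2 ⟨hπ.subset C hC hi, fun h => hCB ?_⟩
        exact hπ.eq_of_mem C hC B hB i hi h
  · have hne : (B \ T).Nonempty := Finset.sdiff_nonempty.2 fun h => hBT (h.antisymm hTB)
    -- Only this `q` contributes. For any other `q'` in `B \ T`, the point `q` would lie in the gap
    -- before `q'` and in a block that meets `T`.
    set q := (B \ T).min' hne with hqdef
    have hqBT : q ∈ B \ T := Finset.min'_mem _ _
    have hqB : q ∈ B := (Finset.mem_sdiff.1 hqBT).1
    have hqT : q ∉ T := (Finset.mem_sdiff.1 hqBT).2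
    have hqS : q ∈ S \ T := Finset.mem_sdiff.2 ⟨hπ.subset B hB hqB, hqT⟩
    have hmin : ∀ i ∈ B, i ∉ T → q ≤ i := fun i hi hiT =>
      Finset.min'_le _ _ (Finset.mem_sdiff.2 ⟨hi, hiT⟩)
    rw [if_neg, zero_add, Finset.sum_eq_single q, if_pos]
    · refine ⟨fun C hC => ?_, B, hB, Finset.insert_subset hqB hTB⟩
      by_cases hCB : C = B
      · right
        rw [hCB, Finset.disjoint_left]
        intro i hi hi'
        simp only [Finset.mem_filter, Finset.mem_sdiff] at hi'
        exact absurd hi'.2 (not_lt.2 (hmin i hi hi'.1.2))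
      · by_cases hd : Disjoint C ((S \ T).filter (· < q))
        · exact Or.inr hd
        left
        obtain ⟨g, hgC, hg⟩ := Finset.not_disjoint_iff.1 hd
        simp only [Finset.mem_filter] at hg
        intro l hl
        have hlT : l ∉ T := fun h => hCB (hπ.eq_of_mem C hC B hB l hl (hTB h))
        refine Finset.mem_filter.2 ⟨Finset.mem_sdiff.2 ⟨hπ.subset C hC hl, hlT⟩, ?_⟩
        by_contra hlq
        rcases (not_lt.1 hlq).eq_or_lt with h | h
        · exact hCB (hπ.eq_of_mem C hC B hB l hl (h ▸ hqB))
        · exact hCB (hπ.noncrossing B hB C hC t g q l (hT t ht g hg.1) hg.2 h (hTB ht) hqB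
            hgC hl).symm
    · intro q' hq' hne'
      rw [if_neg]
      rintro ⟨hsep, C, hC, h⟩
      obtain rfl := huniq C hC _ (Finset.mem_insert_of_mem ht) h
      have hq'C : q' ∈ C := h (Finset.mem_insert_self _ _)
      have hlt : q < q' := lt_of_le_of_ne (hmin q' hq'C (Finset.mem_sdiff.1 hq').2) (Ne.symm hne')
      rcases hsep C hC with h' | h'
      · exact absurd (Finset.mem_filter.1 (h' hq'C)).2 (lt_irrefl _)
      · exact Finset.disjoint_left.1 h' hqB (Finset.mem_filter.2 ⟨hqS, hlt⟩)
    · exact fun h => absurd hqS h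
    · rintro ⟨hsep, -⟩
      rcases hsep B hB with h' | h'
      · exact (Finset.mem_sdiff.1 (h' (hTB ht))).2 ht
      · exact Finset.disjoint_left.1 h' hqB hqS

/-- The value of `ncSumJoined c S T` for an initial segment `T` of `j` elements of a set `S` with
`j + n` elements. -/
noncomputable def ncWeight (c : ℕ → R) (j n : ℕ) : R :=
  -- The conditionals spell out `ncMoment`, which is only defined afterwards, from `ncWeight`; the
  -- index `i` is the size of the gap.
  c j * (if _h : n = 0 then 1 else ncWeight c 1 (n - 1)) +
    ∑ i : Fin n, (if _h : i.1 = 0 then 1 else ncWeight c 1 (i.1 - 1)) *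
      ncWeight c (j + 1) (n - 1 - i)
termination_by n
decreasing_by all_goals omega

/-- The value of `ncSum c S` for a set `S` with `n` elements. -/
noncomputable def ncMoment (c : ℕ → R) (n : ℕ) : R := if n = 0 then 1 else ncWeight c 1 (n - 1)

theorem ncMoment_zero : ncMoment c 0 = 1 := rfl

theorem ncMoment_succ (n : ℕ) : ncMoment c (n + 1) = ncWeight c 1 n := rfl

theorem ncWeight_eq (j n : ℕ) : ncWeight c j n = c j * ncMoment c n +
    ∑ i ∈ Finset.range n, ncMoment c i * ncWeight c (j + 1) (n - 1 - i) := by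
  rw [ncWeight, Finset.sum_range]
  simp only [ncMoment, dite_eq_ite]

/-- The rank of an element runs once through `0, …, |S| - 1`. This turns the sum over the next
element of a block into a sum over gap sizes. -/
theorem sum_card_filter_lt (f : ℕ → R) (S : Finset α) :
    ∑ q ∈ S, f (S.filter (· < q)).card = ∑ i ∈ Finset.range S.card, f i := by
  induction S using Finset.induction_on_max with
  | empty => simp
  | insert a s ha ih =>
    have has : a ∉ s := fun h => lt_irrefl _ (ha a h)
    rw [Finset.sum_insert has, Finset.card_insert_of_notMem has, Finset.sum_range_succ, ← ih,
      add_comm]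
    congr 1
    · refine Finset.sum_congr rfl fun q hq => ?_
      rw [Finset.filter_insert, if_neg (not_lt.2 (ha q hq).le)]
    · rw [Finset.filter_insert, if_neg (lt_irrefl _), Finset.filter_true_of_mem ha]

/-- The two claims feed each other: a full sum over `n + 1` points is the joined sum for the
singleton of the minimum with `n` points left, and a joined sum reduces to full sums over the gap
and the rest, and joined sums with fewer free points. -/
theorem ncSum_eq_and_ncSumJoined_eq (n : ℕ) :
    (∀ S : Finset α, S.card = n → ncSum c S = ncMoment c n) ∧
      ∀ S T : Finset α, T ⊆ S → T.Nonempty → (∀ i ∈ T, ∀ j ∈ S \ T, i < j) → (S \ T).card = n →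
        ncSumJoined c S T = ncWeight c T.card n := by
  induction n using Nat.strong_induction_on with
  | _ n ih =>
  have h1 : ∀ S : Finset α, S.card = n → ncSum c S = ncMoment c n := by
    intro S hS
    rcases n with _ | n
    · rw [Finset.card_eq_zero.1 hS, ncSum_empty, ncMoment_zero]
    have hS0 : S.Nonempty := Finset.card_pos.1 (by omega)
    rw [ncSum_eq_joined c S hS0, ncMoment_succ]
    refine (ih n (by omega)).2 S _ (Finset.singleton_subset_iff.2 (S.min'_mem hS0))
      (Finset.singleton_nonempty _) ?_ ?_
    · intro i hi j hj
      rw [Finset.mem_singleton] at hi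
      subst hi
      rw [Finset.mem_sdiff, Finset.mem_singleton] at hj
      exact lt_of_le_of_ne (S.min'_le j hj.1) (Ne.symm hj.2)
    · rw [Finset.card_sdiff_of_subset (Finset.singleton_subset_iff.2 (S.min'_mem hS0)), hS,
        Finset.card_singleton, Nat.add_sub_cancel]
  refine ⟨h1, fun S T hTS hT0 hT hn => ?_⟩
  rw [ncSumJoined_eq c hTS hT0 hT, ncWeight_eq, h1 _ hn, ← hn,
    ← sum_card_filter_lt (fun i => ncMoment c i * ncWeight c (T.card + 1) ((S \ T).card - 1 - i))]
  congr 1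
  refine Finset.sum_congr rfl fun q hq => ?_
  set G := (S \ T).filter (· < q) with hG
  have hqG : q ∉ G := by simp [hG]
  have hGS : G ⊆ S \ T := Finset.filter_subset _ _
  have hlt : G.card < n := hn ▸ Finset.card_lt_card ⟨hGS, fun h => hqG (h hq)⟩
  have hqT : q ∉ T := (Finset.mem_sdiff.1 hq).2
  have hsd : (S \ G) \ insert q T = (S \ T) \ insert q G := by
    ext i
    simp only [Finset.mem_sdiff, Finset.mem_insert]
    tauto
  have hcard : ((S \ T) \ insert q G).card = (S \ T).card - 1 - G.card := by
    rw [Finset.card_sdiff_of_subset (Finset.insert_subset hq hGS),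
      Finset.card_insert_of_notMem hqG]
    omega
  rw [(ih _ hlt).1 G rfl, ← Finset.card_insert_of_notMem hqT, ← hcard, ← hsd]
  refine congrArg _ ((ih _ ?_).2 _ _ ?_ (Finset.insert_nonempty _ _) ?_ rfl)
  · rw [hsd, hcard]; omega
  · intro i hi
    rcases Finset.mem_insert.1 hi with rfl | hi
    · exact Finset.mem_sdiff.2 ⟨(Finset.mem_sdiff.1 hq).1, hqG⟩
    · exact Finset.mem_sdiff.2 ⟨hTS hi, fun h => (Finset.mem_sdiff.1 (hGS h)).2 hi⟩
  · intro i hi j hj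
    rw [hsd] at hj
    simp only [Finset.mem_sdiff, Finset.mem_insert, not_or] at hj
    rcases Finset.mem_insert.1 hi with rfl | hi
    · by_contra hlt'
      exact hj.2.2 (Finset.mem_filter.2 ⟨Finset.mem_sdiff.2 hj.1,
        lt_of_le_of_ne (not_lt.1 hlt') hj.2.1⟩)
    · exact hT i hi j (Finset.mem_sdiff.2 hj.1)

theorem ncSum_eq_ncMoment (S : Finset α) : ncSum c S = ncMoment c S.card :=
  (ncSum_eq_and_ncSumJoined_eq c _).1 S rfl

theorem ncSumJoined_eq_ncWeight {S T : Finset α} (hTS : T ⊆ S) (hT0 : T.Nonempty)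
    (hT : ∀ i ∈ T, ∀ j ∈ S \ T, i < j) :
    ncSumJoined c S T = ncWeight c T.card (S \ T).card :=
  (ncSum_eq_and_ncSumJoined_eq c _).2 S T hTS hT0 hT rfl

open PowerSeries in
/-- The functional equation for the generating functions of `ncWeight`. -/
theorem mk_ncWeight (j : ℕ) : PowerSeries.mk (ncWeight c j) =
    C (c j) * PowerSeries.mk (ncMoment c) +
      X * (PowerSeries.mk (ncMoment c) * PowerSeries.mk (ncWeight c (j + 1))) := by
  ext n
  rw [coeff_mk, ncWeight_eq, map_add, coeff_C_mul, coeff_mk]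
  congr 1
  rcases n with _ | n
  · simp
  · rw [coeff_succ_X_mul, coeff_mul, Finset.Nat.sum_antidiagonal_eq_sum_range_succ_mk]
    simp

open PowerSeries in
theorem mk_ncMoment : PowerSeries.mk (ncMoment c) = 1 + X * PowerSeries.mk (ncWeight c 1) := by
  ext n
  rcases n with _ | n
  · simp [ncMoment_zero]
  · simp [coeff_succ_X_mul, ncMoment_succ, coeff_one]

end NonCrossingSums

/-! ### Free cumulants: multilinearity, and words in free elements. -/

section Cumulants

theorem IsNCPartition.eq_singleton {α : Type*} [LinearOrder α] {S : Finset α}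
    {π : Finset (Finset α)} (hπ : IsNCPartition S π) (hS : S ∈ π) : π = {S} := by
  refine Finset.eq_singleton_iff_unique_mem.2 ⟨hS, fun C hC => ?_⟩
  obtain ⟨i, hi⟩ := hπ.nonempty C hC
  exact hπ.eq_of_mem C hC S hS i hi (hπ.subset C hC hi)

theorem isNCPartition_singleton {α : Type*} [LinearOrder α] {S : Finset α} (hS : S.Nonempty) :
    IsNCPartition S {S} := by
  refine ⟨by simpa using hS, by simp, by simp, by simp +contextual, by simp +contextual⟩

theorem Finpartition.isNCPartition {n : ℕ} {π : Finpartition (Finset.univ : Finset (Fin n))}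
    (h : IsNonCrossing π) : IsNCPartition Finset.univ π.parts where
  nonempty _ hB := π.nonempty_of_mem_parts hB
  subset _ _ := Finset.subset_univ _
  cover i _ := π.exists_mem (Finset.mem_univ i)
  eq_of_mem _ hB _ hC _ hiB hiC := π.eq_of_mem_parts hB hC hiB hiC
  noncrossing B hB C hC i j k l hij hjk hkl hi hk hj hl := by
    by_contra hne
    exact h B hB C hC hne i j k l hij hjk hkl hi hk hj hl

/-- Passes from `Finpartition` to bare sets of blocks, for which the decomposition into pieces of
the ground set is available. -/
theorem sum_NC_eq {R : Type*} [CommRing R] {n : ℕ} (w : Finset (Fin n) → R) :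
    ∑ π ∈ NC n, ∏ B ∈ π.parts, w B = ∑ π ∈ ncPartitions Finset.univ, ∏ B ∈ π, w B := by
  refine Finset.sum_bij (fun π _ => π.parts) ?_ ?_ ?_ (fun _ _ => rfl)
  · intro π hπ
    exact mem_ncPartitions.2 (Finpartition.isNCPartition (by simpa [NC] using hπ))
  · intro π _ ρ _ h
    exact Finpartition.ext h
  · intro π hπ
    have hπ := mem_ncPartitions.1 hπ
    refine ⟨⟨π, ?_, ?_, ?_⟩, ?_, rfl⟩
    · rw [Finset.supIndep_iff_pairwiseDisjoint]
      intro B hB C hC hBC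
      refine Finset.disjoint_left.2 fun i hiB hiC => hBC (hπ.eq_of_mem B hB C hC i hiB hiC)
    · ext i
      simpa [Finset.mem_sup] using hπ.cover i (Finset.mem_univ i)
    · intro h
      simpa using hπ.nonempty _ h
    · simp only [NC, Finset.mem_filter, Finset.mem_univ, true_and]
      intro B hB C hC hBC i j k l hij hjk hkl hi hk hj hl
      exact hBC (hπ.noncrossing B hB C hC i j k l hij hjk hkl hi hk hj hl)

variable {A : Type*} [Ring A] [Algebra ℂ A] (τ : A →ₗ[ℂ] ℂ)

/-- The free cumulant of the elements indexed by a block. -/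
noncomputable def blockCumulant {n : ℕ} (x : Fin n → A) (B : Finset (Fin n)) : ℂ :=
  freeCumulant τ B.card (fun i => x (B.orderEmbOfFin rfl i))

theorem moment_eq_sum_blockCumulant {n : ℕ} (hn : 0 < n) (x : Fin n → A) :
    τ (List.ofFn x).prod =
      ∑ π ∈ ncPartitions Finset.univ, ∏ B ∈ π, blockCumulant τ x B := by
  rw [moment_eq_sum_freeCumulant τ n hn x]
  exact sum_NC_eq (blockCumulant τ x)

theorem blockCumulant_univ {n : ℕ} (x : Fin n → A) :
    blockCumulant τ x Finset.univ = freeCumulant τ n x := by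
  have hemb : (fun i => x ((Finset.univ : Finset (Fin n)).orderEmbOfFin
      (Finset.card_fin n) i)) = x := by
    funext i
    have := Finset.orderEmbOfFin_unique (Finset.card_fin n) (f := (id : Fin n → Fin n))
      (fun _ => Finset.mem_univ _) strictMono_id
    rw [← this]; rfl
  have hcast : ∀ (m : ℕ) (h : (Finset.univ : Finset (Fin n)).card = m),
      blockCumulant τ x Finset.univ =
        freeCumulant τ m (fun i => x (Finset.univ.orderEmbOfFin h i)) := by
    intro m h; subst h; rfl
  rw [hcast n (Finset.card_fin n), hemb]

-- Every block on the right is proper, so this is the form suited to induction on the order of the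
-- cumulant.
open Classical in
theorem freeCumulant_eq_sub {n : ℕ} (hn : 0 < n) (x : Fin n → A) :
    freeCumulant τ n x = τ (List.ofFn x).prod -
      ∑ π ∈ (ncPartitions Finset.univ).filter (fun π => Finset.univ ∉ π),
        ∏ B ∈ π, blockCumulant τ x B := by
  have hne : (Finset.univ : Finset (Fin n)).Nonempty := ⟨⟨0, hn⟩, Finset.mem_univ _⟩
  have h : (ncPartitions (Finset.univ : Finset (Fin n))).filter
      (fun π => ¬ Finset.univ ∉ π) = {{Finset.univ}} := by
    ext π
    simp only [Finset.mem_filter, mem_ncPartitions, Finset.mem_singleton, not_not]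
    constructor
    · rintro ⟨hπ, h⟩
      exact hπ.eq_singleton h
    · rintro rfl
      exact ⟨isNCPartition_singleton hne, Finset.mem_singleton_self _⟩
  rw [moment_eq_sum_blockCumulant τ hn,
    ← Finset.sum_filter_add_sum_filter_not _ (fun π => Finset.univ ∉ π), h,
    Finset.sum_singleton, Finset.prod_singleton, blockCumulant_univ]
  ring

theorem card_lt_of_univ_notMem {n : ℕ} {π : Finset (Finset (Fin n))} (h : Finset.univ ∉ π)
    {B : Finset (Fin n)} (hB : B ∈ π) : B.card < n := by
  have : B ≠ Finset.univ := fun h' => h (h' ▸ hB)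
  simpa using Finset.card_lt_card (Finset.ssubset_univ_iff.2 this)

/-- Free cumulants of a single element depend only on its moments. -/
theorem SameDistribution.freeCumulant_eq {τ : A →ₗ[ℂ] ℂ} {x y : A} (h : SameDistribution τ x y)
    (n : ℕ) : freeCumulant τ n (fun _ => x) = freeCumulant τ n (fun _ => y) := by
  classical
  induction n using Nat.strong_induction_on with
  | _ n ih =>
  rcases Nat.eq_zero_or_pos n with rfl | hn
  · exact congrArg _ (Subsingleton.elim _ _)
  rw [freeCumulant_eq_sub τ hn, freeCumulant_eq_sub τ hn]
  congr 1
  · simpa using h n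
  · refine Finset.sum_congr rfl fun π hπ => Finset.prod_congr rfl fun B hB => ?_
    exact ih _ (card_lt_of_univ_notMem (Finset.mem_filter.1 hπ).2 hB)

/-- Free cumulants are linear in each argument. -/
theorem freeCumulant_linear {n : ℕ} {x y z : Fin n → A} (i : Fin n) (a : ℂ)
    (hi : x i = a • y i + z i) (hy : ∀ j, j ≠ i → y j = x j) (hz : ∀ j, j ≠ i → z j = x j) :
    freeCumulant τ n x = a * freeCumulant τ n y + freeCumulant τ n z := by
  classical
  induction n using Nat.strong_induction_on with
  | _ n ih =>
  have hn : 0 < n := i.pos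
  have hprod : (List.ofFn x).prod = a • (List.ofFn y).prod + (List.ofFn z).prod := by
    have hx' : x = Function.update x i (a • y i + z i) := by rw [← hi, Function.update_eq_self]
    have hy' : y = Function.update x i (y i) := by
      funext j
      by_cases hj : j = i
      · subst hj; simp
      · simp [hj, hy j hj]
    have hz' : z = Function.update x i (z i) := by
      funext j
      by_cases hj : j = i
      · subst hj; simp
      · simp [hj, hz j hj]
    have h := (MultilinearMap.mkPiAlgebraFin ℂ n A).map_update_add x i (a • y i) (z i)
    rw [MultilinearMap.map_update_smul, ← hx', ← hy', ← hz'] at h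
    simpa only [MultilinearMap.mkPiAlgebraFin_apply] using h
  rw [freeCumulant_eq_sub τ hn, freeCumulant_eq_sub τ hn, freeCumulant_eq_sub τ hn, hprod,
    map_add, map_smul, smul_eq_mul, mul_sub, Finset.mul_sum]
  have hsum : ∑ π ∈ (ncPartitions (Finset.univ : Finset (Fin n))).filter
      (fun π => Finset.univ ∉ π), ∏ B ∈ π, blockCumulant τ x B =
      ∑ π ∈ (ncPartitions (Finset.univ : Finset (Fin n))).filter (fun π => Finset.univ ∉ π),
        (a * ∏ B ∈ π, blockCumulant τ y B + ∏ B ∈ π, blockCumulant τ z B) := by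
    refine Finset.sum_congr rfl fun π hπ => ?_
    obtain ⟨hπ, hπu⟩ := Finset.mem_filter.1 hπ
    rw [mem_ncPartitions] at hπ
    -- Only the block that contains `i` is affected. It is proper, so the induction hypothesis
    -- splits its cumulant, and the other factors agree for `x`, `y` and `z`.
    obtain ⟨B, hB, hiB⟩ := hπ.cover i (Finset.mem_univ i)
    have hother : ∀ w : Fin n → A, (∀ j, j ≠ i → w j = x j) →
        ∏ C ∈ π.erase B, blockCumulant τ w C = ∏ C ∈ π.erase B, blockCumulant τ x C := by
      intro w hw
      refine Finset.prod_congr rfl fun C hC => ?_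
      refine congrArg _ (funext fun j => hw _ fun h => ?_)
      have hjC := C.orderEmbOfFin_mem rfl j
      rw [h] at hjC
      exact (Finset.mem_erase.1 hC).1
        (hπ.eq_of_mem C (Finset.mem_erase.1 hC).2 B hB i hjC hiB)
    rw [← Finset.mul_prod_erase π _ hB, ← Finset.mul_prod_erase π _ hB,
      ← Finset.mul_prod_erase π _ hB, hother y hy, hother z hz]
    obtain ⟨p, hp⟩ : ∃ p, B.orderEmbOfFin rfl p = i := by
      have : i ∈ Set.range (B.orderEmbOfFin rfl) := by rw [Finset.range_orderEmbOfFin]; exact hiB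
      exact this
    have hinj : ∀ j, j ≠ p → B.orderEmbOfFin rfl j ≠ i := fun j hj h =>
      hj ((B.orderEmbOfFin rfl).injective (h.trans hp.symm))
    have := ih B.card (card_lt_of_univ_notMem hπu hB)
      (x := fun j => x (B.orderEmbOfFin rfl j)) (y := fun j => y (B.orderEmbOfFin rfl j))
      (z := fun j => z (B.orderEmbOfFin rfl j)) p (by simpa only [hp] using hi)
      (fun j hj => hy _ (hinj j hj)) (fun j hj => hz _ (hinj j hj))
    rw [blockCumulant, this]
    simp only [blockCumulant]
    ring
  rw [hsum, Finset.sum_add_distrib]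
  ring

/-- The free cumulant as a multilinear map. -/
noncomputable def freeCumulantMultilinear (n : ℕ) : MultilinearMap ℂ (fun _ : Fin n => A) ℂ where
  toFun := freeCumulant τ n
  map_update_add' := by
    intro inst x i y z
    have := freeCumulant_linear τ (x := Function.update x i (y + z))
      (y := Function.update x i y) (z := Function.update x i z) i 1 (by simp)
      (fun j hj => by simp [hj]) (fun j hj => by simp [hj])
    rwa [one_mul] at this
  map_update_smul' := by
    intro inst x i a y
    -- Linearity with all three entries zero reads f = f + f, so a cumulant with a zero entry
    -- vanishes.
    have h0 := freeCumulant_linear τ (x := Function.update x i 0)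
      (y := Function.update x i 0) (z := Function.update x i 0) i 1 (by simp)
      (fun j hj => by simp [hj]) (fun j hj => by simp [hj])
    have := freeCumulant_linear τ (x := Function.update x i (a • y))
      (y := Function.update x i y) (z := Function.update x i 0) i a (by simp)
      (fun j hj => by simp [hj]) (fun j hj => by simp [hj])
    have h0' : freeCumulant τ n (Function.update x i 0) = 0 := by linear_combination -h0
    rw [this, h0', add_zero, smul_eq_mul]

theorem freeCumulantMultilinear_apply (n : ℕ) (x : Fin n → A) :
    freeCumulantMultilinear τ n x = freeCumulant τ n x := rfl

/-- The cumulants of words in `x 0` and `x 0 + x 1`, when `x 0` and `x 1` are free. -/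
theorem FreelyIndependent.freeCumulant_word {τ : A →ₗ[ℂ] ℂ} {x : Fin 2 → A}
    (hx : FreelyIndependent τ x) {k : ℕ} (hk : 0 < k) (p : Fin k → Prop) [DecidablePred p]
    : freeCumulant τ k (fun i => if p i then x 0 else x 0 + x 1) =
      freeCumulant τ k (fun _ => x 0) +
        if ∃ i, p i then 0 else freeCumulant τ k (fun _ => x 1) := by
  classical
  let s : Fin k → Finset (Fin 2) := fun i => if p i then {0} else Finset.univ
  have hs : (fun i => if p i then x 0 else x 0 + x 1) = fun i => ∑ j ∈ s i, x j := by
    funext i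
    by_cases h : p i <;> simp [s, h]
  rw [hs, ← freeCumulantMultilinear_apply, MultilinearMap.map_sum_finset]
  simp only [freeCumulantMultilinear_apply]
  -- In the multilinear expansion all mixed words vanish by freeness. Of the two constant words, the
  -- one in `x 1` occurs only if no letter is forced to be `x 0`.
  have hconst : ∀ r : Fin k → Fin 2, r ≠ (fun _ => 0) → r ≠ (fun _ => 1) →
      freeCumulant τ k (fun i => x (r i)) = 0 := by
    intro r h0 h1
    refine hx k r ?_
    by_contra! h
    rcases (Fin.exists_fin_two.1 ⟨r ⟨0, hk⟩, rfl⟩ : r ⟨0, hk⟩ = 0 ∨ r ⟨0, hk⟩ = 1) with h' | h'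
    · exact h0 (funext fun i => (h i ⟨0, hk⟩).trans h')
    · exact h1 (funext fun i => (h i ⟨0, hk⟩).trans h')
  have hne : (fun _ : Fin k => (0 : Fin 2)) ≠ fun _ => 1 := fun h => by
    simpa using congrFun h ⟨0, hk⟩
  have h0mem : (fun _ : Fin k => (0 : Fin 2)) ∈ Fintype.piFinset s := by
    rw [Fintype.mem_piFinset]
    intro i
    by_cases h : p i <;> simp [s, h]
  by_cases hp : ∃ i, p i
  · obtain ⟨i, hi⟩ := hp
    rw [if_pos ⟨i, hi⟩, add_zero, Finset.sum_eq_single (fun _ => (0 : Fin 2))]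
    · intro r hr hr0
      refine hconst r hr0 fun h => ?_
      have := Fintype.mem_piFinset.1 hr i
      simp [s, hi, h] at this
    · exact fun h => absurd h0mem h
  · rw [if_neg hp, Finset.sum_eq_add (fun _ => (0 : Fin 2)) (fun _ => 1) hne]
    · exact fun r _ hr => hconst r hr.1 hr.2
    · exact fun h => absurd h0mem h
    · refine fun h => absurd (Fintype.mem_piFinset.2 fun i => ?_) h
      push Not at hp
      simp [s, hp i]

theorem moment_pow_eq_ncMoment {τ : A →ₗ[ℂ] ℂ} (h1 : τ 1 = 1) (x : A) (n : ℕ) :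
    τ (x ^ n) = ncMoment (fun k => freeCumulant τ k (fun _ => x)) n := by
  rcases Nat.eq_zero_or_pos n with rfl | hn
  · simp [h1, ncMoment_zero]
  have h := moment_eq_sum_blockCumulant τ hn (fun _ : Fin n => x)
  simp only [List.ofFn_const, List.prod_replicate] at h
  rw [h]
  have := ncSum_eq_ncMoment (fun k => freeCumulant τ k (fun _ => x))
    (Finset.univ : Finset (Fin n))
  rw [Finset.card_fin] at this
  exact this

end Cumulants

/-! ### Moments of the form τ(x S x Sⁿ). -/

section TripleMoment

open Classical in
/-- Without singletons, an element between two elements of a block of a non-crossing partition of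
`{0, …, n + 2}` joins this block if it is the second element. -/
theorem sum_ncPartitions_zero_two {R : Type*} [CommRing R] {c : ℕ → R} (hc : c 1 = 0) (n : ℕ) :
    ∑ π ∈ (ncPartitions (Finset.univ : Finset (Fin (n + 3)))).filter
      (fun π => ∃ B ∈ π, (⟨0, by omega⟩ : Fin (n + 3)) ∈ B ∧ (⟨2, by omega⟩ : Fin (n + 3)) ∈ B),
        ∏ B ∈ π, c B.card = ncWeight c 3 n := by
  set T : Finset (Fin (n + 3)) := {⟨0, by omega⟩, ⟨1, by omega⟩, ⟨2, by omega⟩} with hT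
  have hTcard : T.card = 3 := by
    rw [hT, Finset.card_eq_three]
    exact ⟨_, _, _, by simp, by simp, by simp, rfl⟩
  have hmem : ∀ i : Fin (n + 3), i ∈ T ↔ i.1 ≤ 2 := by
    intro i
    simp only [hT, Finset.mem_insert, Finset.mem_singleton, Fin.ext_iff]
    omega
  have hsub : T ⊆ Finset.univ := Finset.subset_univ _
  have h := ncSumJoined_eq_ncWeight c hsub (Finset.card_pos.1 (by omega)) (by
    intro i hi j hj
    rw [Finset.mem_sdiff, hmem] at hj
    rw [hmem] at hi
    exact Fin.lt_def.2 (by omega))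
  rw [Finset.card_sdiff_of_subset hsub, hTcard, Finset.card_fin, Nat.add_sub_cancel] at h
  rw [← h, ncSumJoined]
  symm
  refine Finset.sum_subset ?_ ?_
  · intro π hπ
    obtain ⟨hπ, B, hB, hTB⟩ := Finset.mem_filter.1 hπ
    exact Finset.mem_filter.2 ⟨hπ, B, hB, hTB ((hmem _).2 (by simp)), hTB ((hmem _).2 (by simp))⟩
  · intro π hπ hπ'
    obtain ⟨hπ, B, hB, h0, h2⟩ := Finset.mem_filter.1 hπ
    have hnc := mem_ncPartitions.1 hπ
    obtain ⟨C, hC, h1⟩ := hnc.cover ⟨1, by omega⟩ (Finset.mem_univ _)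
    have hCB : C ≠ B := by
      rintro rfl
      refine hπ' (Finset.mem_filter.2 ⟨hπ, C, hC, ?_⟩)
      intro i hi
      simp only [hT, Finset.mem_insert, Finset.mem_singleton] at hi
      rcases hi with rfl | rfl | rfl <;> assumption
    -- If the block of the second point is not `B`, it is trapped between two points of `B`; so it
    -- is a singleton and has weight `c 1 = 0`.
    have hC1 : C = {⟨1, by omega⟩} := by
      refine Finset.eq_singleton_iff_unique_mem.2 ⟨h1, fun l hl => ?_⟩
      by_contra hne
      have hl1 : l.1 ≠ 1 := fun h => hne (Fin.ext h)
      have hl0 : l.1 ≠ 0 := fun h => hCB (hnc.eq_of_mem C hC B hB l hl (by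
        rwa [show l = ⟨0, by omega⟩ from Fin.ext h]))
      have hl2 : l.1 ≠ 2 := fun h => hCB (hnc.eq_of_mem C hC B hB l hl (by
        rwa [show l = ⟨2, by omega⟩ from Fin.ext h]))
      refine hCB (hnc.noncrossing B hB C hC ⟨0, by omega⟩ ⟨1, by omega⟩ ⟨2, by omega⟩ l ?_ ?_ ?_
        h0 h2 h1 hl).symm
      · exact Fin.lt_def.2 (by simp)
      · exact Fin.lt_def.2 (by simp)
      · exact Fin.lt_def.2 (by simp; omega)
    refine Finset.prod_eq_zero hC ?_
    rw [hC1, Finset.card_singleton, hc]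

variable {A : Type*} [Ring A] [Algebra ℂ A]

/-- If `x 0` and `x 1` are free, and the cumulants of `x 0` are proportional to the cumulants of
the centered sum `x 0 + x 1`, the moments `τ (x 0 * (x 0 + x 1) * x 0 * (x 0 + x 1) ^ n)`
are given by the cumulants of `x 0 + x 1`. -/
theorem FreelyIndependent.moment_triple {τ : A →ₗ[ℂ] ℂ} {x : Fin 2 → A}
    (hx : FreelyIndependent τ x) {l : ℂ}
    (hl : ∀ k, 0 < k → freeCumulant τ k (fun _ => x 0) =
      l * freeCumulant τ k (fun _ => x 0 + x 1))
    (h1 : freeCumulant τ 1 (fun _ => x 0 + x 1) = 0) (n : ℕ) :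
    τ (x 0 * (x 0 + x 1) * x 0 * (x 0 + x 1) ^ n) =
      l ^ 2 * ncMoment (fun k => freeCumulant τ k (fun _ => x 0 + x 1)) (n + 3) +
        l * (1 - l) * ncWeight (fun k => freeCumulant τ k (fun _ => x 0 + x 1)) 3 n := by
  classical
  set S := x 0 + x 1 with hS
  set c : ℕ → ℂ := fun k => freeCumulant τ k (fun _ => S) with hc
  let P : Fin (n + 3) → Prop := fun i => i.1 = 0 ∨ i.1 = 2
  let y : Fin (n + 3) → A := fun i => if P i then x 0 else S
  have hprod : x 0 * S * x 0 * S ^ n = (List.ofFn y).prod := by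
    have : (fun i : Fin n => y i.succ.succ.succ) = fun _ => S := by
      funext i
      simp [y, P]
    rw [List.ofFn_succ, List.ofFn_succ, List.ofFn_succ, this]
    simp [y, P, mul_assoc]
  -- A single letter `x 0` in a block reduces its cumulant to that of `x 0`, whence a factor `l`,
  -- however many such letters there are.
  have hblock : ∀ B : Finset (Fin (n + 3)), B.Nonempty → blockCumulant τ y B =
      (if ∃ i ∈ B, P i then l else 1) * c B.card := by
    intro B hB
    have h := hx.freeCumulant_word (Finset.card_pos.2 hB) (fun j => P (B.orderEmbOfFin rfl j))
    have hword := hx.freeCumulant_word (Finset.card_pos.2 hB) (fun _ => False)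
    simp only [if_false, exists_false] at hword
    have hex : (∃ j, P (B.orderEmbOfFin rfl j)) ↔ ∃ i ∈ B, P i := by
      constructor
      · rintro ⟨j, hj⟩
        exact ⟨_, B.orderEmbOfFin_mem rfl j, hj⟩
      · rintro ⟨i, hi, hPi⟩
        have : i ∈ Set.range (B.orderEmbOfFin rfl) := by
          rw [Finset.range_orderEmbOfFin]; exact hi
        obtain ⟨j, rfl⟩ := this
        exact ⟨j, hPi⟩
    rw [blockCumulant]
    change freeCumulant τ B.card (fun i => if P (B.orderEmbOfFin rfl i) then x 0 else S) = _
    rw [h]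
    by_cases hP : ∃ i ∈ B, P i
    · rw [if_pos (hex.2 hP), if_pos hP, add_zero, hl _ (Finset.card_pos.2 hB)]
    · rw [if_neg fun h => hP (hex.1 h), if_neg hP, one_mul, ← hword]
  rw [hprod, moment_eq_sum_blockCumulant τ (by omega), ← sum_ncPartitions_zero_two (c := c) h1 n]
  have hm := ncSum_eq_ncMoment c (Finset.univ : Finset (Fin (n + 3)))
  rw [Finset.card_fin] at hm
  rw [← hm, ncSum, Finset.sum_filter, Finset.mul_sum, Finset.mul_sum, ← Finset.sum_add_distrib]
  refine Finset.sum_congr rfl fun π hπ => ?_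
  have hπ := mem_ncPartitions.1 hπ
  obtain ⟨B, hB, h0⟩ := hπ.cover ⟨0, by omega⟩ (Finset.mem_univ _)
  obtain ⟨C, hC, h2⟩ := hπ.cover ⟨2, by omega⟩ (Finset.mem_univ _)
  have hfilter : π.filter (fun D => ∃ i ∈ D, P i) = {B, C} := by
    ext D
    simp only [Finset.mem_filter, Finset.mem_insert, Finset.mem_singleton]
    constructor
    · rintro ⟨hD, i, hi, h | h⟩
      · rw [show i = ⟨0, by omega⟩ from Fin.ext h] at hi
        exact Or.inl (hπ.eq_of_mem D hD B hB _ hi h0)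
      · rw [show i = ⟨2, by omega⟩ from Fin.ext h] at hi
        exact Or.inr (hπ.eq_of_mem D hD C hC _ hi h2)
    · rintro (rfl | rfl)
      · exact ⟨hB, _, h0, Or.inl rfl⟩
      · exact ⟨hC, _, h2, Or.inr rfl⟩
  rw [Finset.prod_congr rfl fun D hD => hblock D (hπ.nonempty D hD), Finset.prod_mul_distrib,
    ← Finset.prod_filter, hfilter, Finset.prod_const]
  -- The power of `l` is the number of distinct blocks among `B` and `C`; the case of one block uses
  -- l = l² + l(1 - l).
  by_cases hBC : B = C
  · subst hBC
    rw [if_pos ⟨B, hB, h0, h2⟩, Finset.pair_eq_singleton, Finset.card_singleton]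
    ring
  · rw [if_neg, Finset.card_pair hBC]
    · ring
    · rintro ⟨D, hD, h0', h2'⟩
      exact hBC ((hπ.eq_of_mem B hB D hD _ h0 h0').trans (hπ.eq_of_mem D hD C hC _ h2' h2))

end TripleMoment

/-! ### The quadratic equation, the regression relation and the cumulant recursion. -/

section MeixnerSeries

open PowerSeries

variable {K : Type*} [Field K]

/-- The quadratic equation for the moment generating function of a free Meixner law of
variance `s`. -/
def IsMeixnerSeries (a b s : K) (M : K⟦X⟧) : Prop :=
  C b * (M - 1) ^ 2 + C a * C s * X * M * (M - 1) + C s ^ 2 * X ^ 2 * M ^ 2 = C s * (M - 1)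

theorem mk_ncMoment_ne_zero (c : ℕ → K) : PowerSeries.mk (ncMoment c) ≠ 0 := fun h => by
  have := congrArg (coeff 0) h
  simp [ncMoment_zero] at this

theorem coeff_zero_ncWeight (c : ℕ → K) (j : ℕ) : ncWeight c j 0 = c j := by
  rw [ncWeight_eq]; simp [ncMoment_zero]

theorem mk_eq_C_add_X_mul (f : ℕ → K) :
    PowerSeries.mk f = C (f 0) + X * PowerSeries.mk (fun n => f (n + 1)) := by
  ext n
  rcases n with _ | n
  · simp
  · simp [coeff_succ_X_mul]

/-- The relations between the moments and the weights of the partitions that join the first three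
points which characterize the free Meixner laws. -/
theorem ncWeight_three_iff_isMeixnerSeries {a b s : K} {c : ℕ → K} (h1 : c 1 = 0) (h2 : c 2 = s)
    (hbs : 2 * b + s ≠ 0) :
    (∀ n, (b + s) ^ 2 * ncWeight c 3 n = b ^ 2 * ncMoment c (n + 3) +
        2 * b * a * s * ncMoment c (n + 2) + (b + a ^ 2) * s ^ 2 * ncMoment c (n + 1) +
          a * s ^ 3 * ncMoment c n) ↔ IsMeixnerSeries a b s (PowerSeries.mk (ncMoment c)) := by
  have e0 := mk_ncMoment c
  have e1 := mk_ncWeight c 1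
  have e2 := mk_ncWeight c 2
  rw [h1, map_zero, zero_mul, zero_add] at e1
  rw [h2] at e2
  have d0 := mk_eq_C_add_X_mul (ncMoment c)
  have d1 := mk_eq_C_add_X_mul (fun n => ncMoment c (n + 1))
  have d2 := mk_eq_C_add_X_mul (fun n => ncMoment c (n + 1 + 1))
  simp only [ncMoment_zero, map_one] at d0
  have hX : (X : K⟦X⟧) ≠ 0 := X_ne_zero
  have hM0 := mk_ncMoment_ne_zero c
  have m1 : ncMoment c (0 + 1) = 0 := by rw [ncMoment_succ, coeff_zero_ncWeight, h1]
  have f1 : PowerSeries.mk (fun n => ncMoment c (n + 1)) = PowerSeries.mk (ncWeight c 1) := rfl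
  have f2 : PowerSeries.mk (fun n => ncMoment c (n + 1 + 1)) =
      PowerSeries.mk (ncMoment c) * PowerSeries.mk (ncWeight c 2) := by
    rw [m1, map_zero, zero_add, f1, e1] at d1
    exact (mul_left_cancel₀ hX d1).symm
  have m2 : ncMoment c (0 + 1 + 1) = s := by
    have := congrArg (coeff 0) f2
    simpa [ncMoment_zero, coeff_zero_ncWeight, h2] using this
  rw [m2] at d2
  rw [m1, map_zero, zero_add] at d1
  set M := PowerSeries.mk (ncMoment c) with hM
  set W1 := PowerSeries.mk (ncWeight c 1)
  set W2 := PowerSeries.mk (ncWeight c 2)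
  set W3 := PowerSeries.mk (ncWeight c (2 + 1)) with hW3
  set M1 := PowerSeries.mk (fun n => ncMoment c (n + 1)) with hM1
  set M2 := PowerSeries.mk (fun n => ncMoment c (n + 1 + 1)) with hM2
  set M3 := PowerSeries.mk (fun n => ncMoment c (n + 1 + 1 + 1)) with hM3
  have hiff : (∀ n, (b + s) ^ 2 * ncWeight c 3 n = b ^ 2 * ncMoment c (n + 3) +
        2 * b * a * s * ncMoment c (n + 2) + (b + a ^ 2) * s ^ 2 * ncMoment c (n + 1) +
          a * s ^ 3 * ncMoment c n) ↔
      (C b ^ 2 * M3 + 2 * C b * C a * C s * M2 + (C b + C a ^ 2) * C s ^ 2 * M1 +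
        C a * C s ^ 3 * M) - (C b + C s) ^ 2 * W3 = 0 := by
    rw [sub_eq_zero, eq_comm (b := (C b + C s) ^ 2 * W3), PowerSeries.ext_iff]
    refine forall_congr' fun n => ?_
    have h2C : (2 : K⟦X⟧) = C 2 := (map_ofNat C 2).symm
    have c1 : (C b + C s) ^ 2 = C ((b + s) ^ 2) := by rw [map_pow, map_add]
    have c2 : (C b + C a ^ 2) * C s ^ 2 = C ((b + a ^ 2) * s ^ 2) := by
      rw [map_mul, map_add, map_pow, map_pow]
    rw [c1, c2]
    simp only [h2C, ← map_pow, ← map_mul, coeff_C_mul, hM, hM1, hM2, hM3, hW3, coeff_mk, map_add]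
  rw [hiff, IsMeixnerSeries, ← sub_eq_zero (b := C s * (M - 1))]
  set D := (C b ^ 2 * M3 + 2 * C b * C a * C s * M2 + (C b + C a ^ 2) * C s ^ 2 * M1 +
        C a * C s ^ 3 * M) - (C b + C s) ^ 2 * W3 with hD
  set P := C b * (M - 1) ^ 2 + C a * C s * X * M * (M - 1) + C s ^ 2 * X ^ 2 * M ^ 2 -
    C s * (M - 1) with hP
  -- The factorization behind the equivalence. The shifted moment series and `W3` are all eliminated
  -- in favour of `M`; `c 1 = 0` and `c 2 = s` give M - 1 = s X² M² + X³ M² W3.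
  have hfac : P * (C b * (1 + M) + C s + C a * C s * X * M) = M ^ 2 * X ^ 3 * D := by
    have g1 : X * M1 = M - 1 := by rw [d0]; ring
    have g2 : X ^ 2 * M2 = M - 1 := by rw [← g1, d1]; ring
    have g3 : X ^ 3 * M3 = M - 1 - C s * X ^ 2 := by rw [← g2, d2]; ring
    have g4 : M ^ 2 * X ^ 3 * W3 = M - 1 - C s * X ^ 2 * M ^ 2 := by
      rw [← g1, f1, e1, e2]; ring
    rw [hD, hP]
    linear_combination (-M ^ 2 * C b ^ 2) * g3 - M ^ 2 * (2 * C b * C a * C s * X) * g2 -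
      M ^ 2 * ((C b + C a ^ 2) * C s ^ 2 * X ^ 2) * g1 + (C b + C s) ^ 2 * g4
  -- Its constant term is 2b + s, since `M` has constant term 1.
  have hL : C b * (1 + M) + C s + C a * C s * X * M ≠ 0 := by
    intro h
    have := congrArg constantCoeff h
    have hM0' : constantCoeff M = 1 := by
      rw [← coeff_zero_eq_constantCoeff_apply, hM, coeff_mk, ncMoment_zero]
    simp only [map_add, map_mul, constantCoeff_C, map_one, hM0', constantCoeff_X, map_zero] at this
    exact hbs (by linear_combination this)
  constructor
  · intro h
    rw [h, mul_zero] at hfac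
    exact (mul_eq_zero.1 hfac).resolve_right hL
  · intro h
    rw [h, zero_mul] at hfac
    exact (mul_eq_zero.1 hfac.symm).resolve_left
      (mul_ne_zero (pow_ne_zero _ hM0) (pow_ne_zero _ hX))

/-- The recursion for the generating functions of the weights of a Meixner series. -/
theorem IsMeixnerSeries.mk_ncWeight_eq {a b s : K} {c : ℕ → K} (h1 : c 1 = 0) (h2 : c 2 = s)
    (h : IsMeixnerSeries a b s (PowerSeries.mk (ncMoment c))) (k : ℕ) :
    C s * PowerSeries.mk (ncWeight c (k + 3)) =
      C a * C s * PowerSeries.mk (ncWeight c (k + 2)) +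
        C b * (X * PowerSeries.mk (ncWeight c 2) * PowerSeries.mk (ncWeight c (k + 2)) +
          ∑ i ∈ Finset.range k, C (c (i + 2)) * PowerSeries.mk (ncWeight c (k + 1 - i))) := by
  have hX : (X : K⟦X⟧) ≠ 0 := X_ne_zero
  have hM0 := mk_ncMoment_ne_zero c
  induction k with
  | zero =>
    have e0 := mk_ncMoment c
    have e1 := mk_ncWeight c 1
    have e2 := mk_ncWeight c 2
    rw [h1, map_zero, zero_mul, zero_add] at e1
    rw [h2] at e2
    rw [IsMeixnerSeries] at h
    simp only [Finset.range_zero, Finset.sum_empty, add_zero, zero_add]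
    set M := PowerSeries.mk (ncMoment c) with hM
    set W1 := PowerSeries.mk (ncWeight c 1)
    -- Since `c 1 = 0`. Substituted into the quadratic equation, this leaves X³ M² times the claim.
    have g1 : M - 1 = X ^ 2 * M * PowerSeries.mk (ncWeight c 2) := by
      linear_combination e0 + X * e1
    have e2' : PowerSeries.mk (ncWeight c 2) = C s * M + X * (M * PowerSeries.mk (ncWeight c 3)) :=
      e2
    rw [g1] at h
    refine mul_left_cancel₀ (mul_ne_zero (pow_ne_zero 3 hX) (pow_ne_zero 2 hM0)) ?_
    linear_combination (-C s * X ^ 2 * M) * e2' - h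
  | succ k ih =>
    set M := PowerSeries.mk (ncMoment c) with hM
    -- Subtracting M times the constant terms from the identity for `k` replaces each W_j by W_j -
    -- c_j M = X M W_{j+1}. Division by X M then gives the identity for `k + 1`; the product X W_2
    -- W_{k+2} supplies the new summand c_{k+2} W_2.
    have hc := congrArg constantCoeff ih
    simp only [← coeff_zero_eq_constantCoeff_apply, coeff_C_mul, map_add, coeff_mk, mul_assoc,
      map_sum, coeff_zero_X_mul, zero_add, coeff_zero_ncWeight] at hc
    have hc' := congrArg (C (R := K)) hc
    simp only [map_mul, map_add, map_sum] at hc'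
    have e2 := mk_ncWeight c (k + 2)
    have e3 := mk_ncWeight c (k + 3)
    have hsum : ∑ i ∈ Finset.range k, C (c (i + 2)) * PowerSeries.mk (ncWeight c (k + 1 - i)) =
        (∑ i ∈ Finset.range k, C (c (i + 2)) * C (c (k + 1 - i))) * M +
          X * M * ∑ i ∈ Finset.range k,
            C (c (i + 2)) * PowerSeries.mk (ncWeight c (k + 1 + 1 - i)) := by
      rw [Finset.sum_mul, Finset.mul_sum, ← Finset.sum_add_distrib]
      refine Finset.sum_congr rfl fun i hi => ?_
      have hik : k + 1 + 1 - i = k + 1 - i + 1 := by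
        have := Finset.mem_range.1 hi
        omega
      rw [mk_ncWeight c (k + 1 - i), hik]
      ring
    rw [Finset.sum_range_succ, show k + 1 + 1 - k = 2 by omega]
    rw [hsum] at ih
    refine mul_left_cancel₀ (mul_ne_zero hX hM0) ?_
    rw [show k + 1 + 3 = k + 3 + 1 by ring, show k + 1 + 2 = k + 2 + 1 by ring]
    rw [← hM] at e2 e3
    rw [show k + 2 + 1 = k + 3 by ring] at e2 ⊢
    linear_combination ih - M * hc' - C s * e3 +
      (C a * C s + C b * X * PowerSeries.mk (ncWeight c 2)) * e2

/-- The cumulants of a Meixner series are proportional to the variance. -/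
theorem IsMeixnerSeries.cumulants_proportional {a b s s' : K} (hs : s ≠ 0) (hs' : s' ≠ 0)
    {c c' : ℕ → K} (h1 : c 1 = 0) (h2 : c 2 = s) (h1' : c' 1 = 0) (h2' : c' 2 = s')
    (h : IsMeixnerSeries a b s (PowerSeries.mk (ncMoment c)))
    (h' : IsMeixnerSeries a b s' (PowerSeries.mk (ncMoment c'))) (k : ℕ) (hk : 0 < k) :
    s' * c k = s * c' k := by
  -- Constant terms of the series recursion. With c_k = s r_k both sides scale by s², so the r_k
  -- obey a recursion, with r_1 = 0 and r_2 = 1, that does not involve `s`.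
  have key : ∀ {s : K} {c : ℕ → K}, c 1 = 0 → c 2 = s →
      IsMeixnerSeries a b s (PowerSeries.mk (ncMoment c)) → ∀ k, s * c (k + 3) =
        a * (s * c (k + 2)) + b * ∑ i ∈ Finset.range k, c (i + 2) * c (k + 1 - i) := by
    intro s c h1 h2 h k
    have hc := congrArg constantCoeff (h.mk_ncWeight_eq h1 h2 k)
    simpa only [← coeff_zero_eq_constantCoeff_apply, coeff_C_mul, map_add, coeff_mk, mul_assoc,
      map_sum, coeff_zero_X_mul, zero_add, coeff_zero_ncWeight] using hc
  induction k using Nat.strong_induction_on with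
  | _ k ih =>
  rcases k with _ | _ | _ | k
  · omega
  · simp [h1, h1']
  · simp [h2, h2', mul_comm]
  · have hsum : s' ^ 2 * ∑ i ∈ Finset.range k, c (i + 2) * c (k + 1 - i) =
        s ^ 2 * ∑ i ∈ Finset.range k, c' (i + 2) * c' (k + 1 - i) := by
      rw [Finset.mul_sum, Finset.mul_sum]
      refine Finset.sum_congr rfl fun i hi => ?_
      have hi := Finset.mem_range.1 hi
      have i1 := ih (i + 2) (by omega) (by omega)
      have i2 := ih (k + 1 - i) (by omega) (by omega)
      linear_combination s' * c (k + 1 - i) * i1 + s * c' (i + 2) * i2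
    have i3 := ih (k + 2) (by omega) (by omega)
    refine mul_left_cancel₀ (mul_ne_zero hs hs') ?_
    linear_combination s' ^ 2 * key h1 h2 h k - s ^ 2 * key h1' h2' h' k + b * hsum +
      a * s * s' * i3

end MeixnerSeries

/-! ### From formal power series to analytic functions near zero. -/

section FormalEvaluation

open Filter Topology

/-- The function `f` is near `0` the absolutely convergent sum of the power series `p`. -/
def PowerSeries.EvaluatesTo (p : PowerSeries ℂ) (f : ℂ → ℂ) : Prop :=
  ∀ᶠ x in 𝓝 (0 : ℂ), Summable (fun n => ‖PowerSeries.coeff n p * x ^ n‖) ∧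
    HasSum (fun n => PowerSeries.coeff n p * x ^ n) (f x)

namespace PowerSeries.EvaluatesTo

variable {p q : PowerSeries ℂ} {f g : ℂ → ℂ}

theorem const (a : ℂ) : (PowerSeries.C a).EvaluatesTo fun _ => a := by
  refine Eventually.of_forall fun x => ?_
  have h : ∀ n, n ≠ 0 → PowerSeries.coeff n (PowerSeries.C a) * x ^ n = 0 := fun n hn => by
    simp [PowerSeries.coeff_C, hn]
  have hs := hasSum_single 0 h
  refine ⟨summable_of_ne_finset_zero (s := {0}) fun n hn => ?_, by simpa using hs⟩
  rw [h n (by simpa using hn), norm_zero]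

theorem var : (PowerSeries.X : PowerSeries ℂ).EvaluatesTo fun x => x := by
  refine Eventually.of_forall fun x => ?_
  have h : ∀ n, n ≠ 1 → PowerSeries.coeff n (PowerSeries.X : PowerSeries ℂ) * x ^ n = 0 :=
    fun n hn => by simp [PowerSeries.coeff_X, hn]
  have hs := hasSum_single 1 h
  refine ⟨summable_of_ne_finset_zero (s := {1}) fun n hn => ?_, by simpa using hs⟩
  rw [h n (by simpa using hn), norm_zero]

theorem add (hp : p.EvaluatesTo f) (hq : q.EvaluatesTo g) :
    (p + q).EvaluatesTo fun x => f x + g x := by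
  filter_upwards [hp, hq] with x hf hg
  simp only [map_add, add_mul]
  exact ⟨Summable.of_nonneg_of_le (fun _ => norm_nonneg _) (fun _ => norm_add_le _ _)
    (hf.1.add hg.1), hf.2.add hg.2⟩

/-- Absolute convergence, required by the definition, makes the Cauchy product converge to the
product. -/
theorem mul (hp : p.EvaluatesTo f) (hq : q.EvaluatesTo g) :
    (p * q).EvaluatesTo fun x => f x * g x := by
  filter_upwards [hp, hq] with x hf hg
  have h : ∀ n, PowerSeries.coeff n (p * q) * x ^ n = ∑ kl ∈ Finset.HasAntidiagonal.antidiagonal n,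
      (PowerSeries.coeff kl.1 p * x ^ kl.1) * (PowerSeries.coeff kl.2 q * x ^ kl.2) := by
    intro n
    rw [PowerSeries.coeff_mul, Finset.sum_mul]
    refine Finset.sum_congr rfl fun kl hkl => ?_
    rw [← Finset.HasAntidiagonal.mem_antidiagonal.1 hkl, pow_add]
    ring
  simp only [h]
  have hs := summable_norm_sum_mul_antidiagonal_of_summable_norm hf.1 hg.1
  refine ⟨hs, ?_⟩
  have := tsum_mul_tsum_eq_tsum_sum_antidiagonal_of_summable_norm hf.1 hg.1
  rw [hf.2.tsum_eq, hg.2.tsum_eq] at this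
  rw [this]
  exact hs.of_norm.hasSum

theorem sub (hp : p.EvaluatesTo f) (hq : q.EvaluatesTo g) :
    (p - q).EvaluatesTo fun x => f x - g x := by
  have h := hp.add ((const (-1)).mul hq)
  have e : p + PowerSeries.C (-1) * q = p - q := by simp [sub_eq_add_neg]
  rw [e] at h
  simpa [sub_eq_add_neg] using h

theorem hasFPowerSeriesAt (hp : p.EvaluatesTo f) :
    HasFPowerSeriesAt f (FormalMultilinearSeries.ofScalars ℂ fun n => PowerSeries.coeff n p) 0 := by
  rw [hasFPowerSeriesAt_iff]
  filter_upwards [hp] with x hx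
  simpa [FormalMultilinearSeries.coeff_ofScalars, mul_comm] using hx.2

/-- Zeros that accumulate at 0 force an analytic function to vanish near 0, and with it all
coefficients. -/
theorem eq_zero_of_frequently (hp : p.EvaluatesTo f) (hf : ∃ᶠ x in 𝓝[≠] 0, f x = 0) : p = 0 := by
  have h := hp.hasFPowerSeriesAt
  have h0 := h.eq_zero_of_eventually (h.analyticAt.frequently_zero_iff_eventually_zero.1 hf)
  rw [FormalMultilinearSeries.ofScalars_series_eq_zero] at h0
  ext n
  exact congrFun h0 n

theorem eventually_eq_zero (hp : p.EvaluatesTo f) (h0 : p = 0) : ∀ᶠ x in 𝓝 0, f x = 0 := by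
  filter_upwards [hp] with x hx
  have := hx.2
  simp only [h0, map_zero, zero_mul] at this
  exact this.unique hasSum_zero

end PowerSeries.EvaluatesTo

end FormalEvaluation

/-! ### Free Meixner laws through their Cauchy transforms. -/

section CauchyTransform

open MeasureTheory Filter Topology

variable {μ : Measure ℝ}

theorem IsCompactlySupportedProbability.exists_ae_bound (hμ : IsCompactlySupportedProbability μ) :
    ∃ r : ℝ, 0 < r ∧ ∀ᵐ y ∂μ, |y| ≤ r := by
  obtain ⟨-, r, hr⟩ := hμ
  refine ⟨max r 1, lt_max_of_lt_right one_pos, ?_⟩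
  have : ∀ᵐ y ∂μ, y ∈ Set.Icc (-r) r := by
    rw [ae_iff]
    exact hr
  filter_upwards [this] with y hy
  exact (abs_le.2 hy).trans (le_max_left _ _)

/-- The generating function of the moments, near zero. -/
theorem evaluatesTo_mk_moments (hμ : IsCompactlySupportedProbability μ) :
    (PowerSeries.mk fun n => ((∫ y, y ^ n ∂μ : ℝ) : ℂ)).EvaluatesTo
      fun x => ∫ y : ℝ, 1 / (1 - x * y) ∂μ := by
  obtain ⟨r, hr, hb⟩ := hμ.exists_ae_bound
  have hμ1 := hμ.1
  have hball : ∀ᶠ x in 𝓝 (0 : ℂ), ‖x‖ < r⁻¹ := by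
    filter_upwards [Metric.ball_mem_nhds (0 : ℂ) (inv_pos.2 hr)] with x hx
    simpa using hx
  filter_upwards [hball] with x hx
  have hxr : ‖x‖ * r < 1 := by
    have := mul_lt_mul_of_pos_right hx hr
    rwa [inv_mul_cancel₀ hr.ne'] at this
  have hxr0 : 0 ≤ ‖x‖ * r := by positivity
  have hbound : ∀ᵐ (y : ℝ) ∂μ, ‖x * (y : ℂ)‖ ≤ ‖x‖ * r := by
    filter_upwards [hb] with y hy
    rw [norm_mul, Complex.norm_real, Real.norm_eq_abs]
    gcongr
  have hint : ∀ n : ℕ, Integrable (fun y : ℝ => (x * (y : ℂ)) ^ n) μ := by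
    intro n
    refine Integrable.of_bound (C := (‖x‖ * r) ^ n) (by fun_prop) ?_
    filter_upwards [hbound] with y hy
    rw [norm_pow]
    gcongr
  have hnorm : ∀ n : ℕ, ∫ y : ℝ, ‖(x * (y : ℂ)) ^ n‖ ∂μ ≤ (‖x‖ * r) ^ n := by
    intro n
    have h := integral_mono_ae (hint n).norm (integrable_const ((‖x‖ * r) ^ n)) (by
      filter_upwards [hbound] with y hy
      rw [norm_pow]
      gcongr)
    simpa using h
  have hterm : ∀ n : ℕ, PowerSeries.coeff n
      (PowerSeries.mk fun n => ((∫ y, y ^ n ∂μ : ℝ) : ℂ)) * x ^ n =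
        ∫ y : ℝ, (x * (y : ℂ)) ^ n ∂μ := by
    intro n
    rw [PowerSeries.coeff_mk, ← integral_complex_ofReal, mul_comm, ← integral_const_mul]
    congr 1
    funext y
    rw [mul_pow, Complex.ofReal_pow]
  have hsummable : Summable fun n : ℕ => ∫ y : ℝ, ‖(x * (y : ℂ)) ^ n‖ ∂μ :=
    Summable.of_nonneg_of_le (fun n => integral_nonneg fun y => norm_nonneg _) hnorm
      (summable_geometric_of_lt_one hxr0 hxr)
  simp only [hterm]
  refine ⟨Summable.of_nonneg_of_le (fun _ => norm_nonneg _)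
    (fun n => norm_integral_le_integral_norm _) hsummable, ?_⟩
  have h := hasSum_integral_of_summable_integral_norm hint hsummable
  have heq : ∫ y : ℝ, ∑' n : ℕ, (x * (y : ℂ)) ^ n ∂μ = ∫ y : ℝ, 1 / (1 - x * y) ∂μ := by
    refine integral_congr_ae ?_
    filter_upwards [hbound] with y hy
    rw [tsum_geometric_of_norm_lt_one (hy.trans_lt hxr), one_div]
  rwa [heq] at h

/-- The Cauchy transform at `x⁻¹`. -/
theorem cauchyTransform_inv {x : ℂ} (hx : x ≠ 0) :
    cauchyTransform μ x⁻¹ = x * ∫ y : ℝ, 1 / (1 - x * y) ∂μ := by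
  rw [cauchyTransform, ← integral_const_mul]
  congr 1
  funext y
  rw [mul_one_div, one_div, show (1 : ℂ) - x * y = x * (x⁻¹ - y) by rw [mul_sub, mul_inv_cancel₀ hx],
    div_mul_eq_div_div, div_self hx, one_div]

/-- The integrand has nonpositive imaginary part. Hence the sign condition on the branch in
`IsFreeMeixnerLaw` is automatic. -/
theorem cauchyTransform_im_nonpos (hμ : IsCompactlySupportedProbability μ) {z : ℂ}
    (hz : 0 < z.im) : (cauchyTransform μ z).im ≤ 0 := by
  have := hμ.1
  have hne : ∀ y : ℝ, z - (y : ℂ) ≠ 0 := fun y h => by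
    have := congrArg Complex.im h
    simp at this
    exact hz.ne' this
  have hint : Integrable (fun y : ℝ => 1 / (z - (y : ℂ))) μ := by
    refine Integrable.of_bound (C := 1 / z.im) ?_ (Eventually.of_forall fun y => ?_)
    · refine Continuous.aestronglyMeasurable ?_
      exact Continuous.div continuous_const (by fun_prop) hne
    · rw [norm_div, norm_one]
      refine one_div_le_one_div_of_le hz ?_
      have := Complex.abs_im_le_norm (z - (y : ℂ))
      rw [Complex.sub_im, Complex.ofReal_im, sub_zero, abs_of_pos hz] at this
      exact this
  have him : (cauchyTransform μ z).im = ∫ y : ℝ, (1 / (z - (y : ℂ))).im ∂μ := by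
    have := integral_im (𝕜 := ℂ) hint
    exact this.symm
  rw [him]
  refine integral_nonpos fun y => ?_
  simp only [one_div, Complex.inv_im, Complex.sub_im, Complex.ofReal_im, sub_zero, Pi.zero_apply]
  exact div_nonpos_of_nonpos_of_nonneg (by linarith) (Complex.normSq_nonneg _)

theorem differentiableOn_cauchyTransform (hμ : IsCompactlySupportedProbability μ) :
    DifferentiableOn ℂ (cauchyTransform μ) {z | 0 < z.im} := by
  have := hμ.1
  have h : cauchyTransform μ = fun z => -resolventTransform μ z := by
    funext z
    rw [cauchyTransform, resolventTransform_apply, ← integral_neg]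
    congr 1
    funext y
    rw [resolvent, Ring.inverse_eq_inv', ← inv_neg, one_div]
    simp
  rw [h]
  refine DifferentiableOn.neg ?_
  refine (analyticOn_resolventTransform (μ := μ)).differentiableOn.mono ?_
  rintro z hz ⟨y, -, rfl⟩
  simp at hz

-- Collected in powers of `M`; with z = 1/X and G = X M it reads (bz² + az + 1)G² - ((1 + 2b)z + a)G
-- + (1 + b) = 0.
open PowerSeries in
theorem isMeixnerSeries_one_iff {a b : ℂ} {M : PowerSeries ℂ} :
    IsMeixnerSeries a b 1 M ↔
      (C b + C a * X + X * X) * (M * M) - (C (1 + 2 * b) + C a * X) * M + C (1 + b) = 0 := by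
  have e1 : (C (1 + 2 * b) : PowerSeries ℂ) = 1 + 2 * C b := by
    rw [map_add, map_mul, map_one, map_ofNat]
  have e2 : (C (1 + b) : PowerSeries ℂ) = 1 + C b := by rw [map_add, map_one]
  rw [IsMeixnerSeries, e1, e2, map_one, ← sub_eq_zero]
  refine Eq.congr ?_ rfl
  ring

/-- Approach 0 along the negative imaginary axis. The upper half plane in `z = x⁻¹` only touches `x
= 0`, so the statement is about frequency. -/
theorem frequently_im_inv_pos : ∃ᶠ x : ℂ in 𝓝[≠] 0, 0 < (x⁻¹).im := by
  have ht : Tendsto (fun e : ℝ => -Complex.I * (e : ℂ)) (𝓝[>] 0) (𝓝[≠] 0) := by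
    refine tendsto_nhdsWithin_iff.2 ⟨?_, ?_⟩
    · have : Continuous fun e : ℝ => -Complex.I * (e : ℂ) := by fun_prop
      have h := this.tendsto 0
      simp only [Complex.ofReal_zero, mul_zero] at h
      exact h.mono_left nhdsWithin_le_nhds
    · filter_upwards [self_mem_nhdsWithin] with e he
      have : (e : ℂ) ≠ 0 := Complex.ofReal_ne_zero.2 (ne_of_gt he)
      simpa using this
  refine ht.frequently (Eventually.frequently ?_)
  filter_upwards [self_mem_nhdsWithin] with e he
  have he : 0 < e := he
  simpa [mul_inv, Complex.inv_I, ← Complex.ofReal_inv] using he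

/-- The free Meixner laws are characterized by a quadratic equation for the moment generating
function. -/
theorem isFreeMeixnerLaw_iff (hμ : IsCompactlySupportedProbability μ) (a b : ℝ) :
    IsFreeMeixnerLaw a b μ ↔
      IsMeixnerSeries (a : ℂ) b 1 (PowerSeries.mk fun n => ((∫ y, y ^ n ∂μ : ℝ) : ℂ)) := by
  have hM := evaluatesTo_mk_moments hμ
  rw [isMeixnerSeries_one_iff]
  set M := PowerSeries.mk fun n => ((∫ y, y ^ n ∂μ : ℝ) : ℂ)
  set g : ℂ → ℂ := fun x => ∫ y : ℝ, 1 / (1 - x * y) ∂μ with hg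
  have hD := ((PowerSeries.EvaluatesTo.const (b : ℂ)).add
    ((PowerSeries.EvaluatesTo.const (a : ℂ)).mul .var)).add (.mul .var .var)
  have hQ := ((hD.mul (hM.mul hM)).sub (((PowerSeries.EvaluatesTo.const (1 + 2 * (b : ℂ))).add
    ((PowerSeries.EvaluatesTo.const (a : ℂ)).mul .var)).mul hM)).add (.const (1 + (b : ℂ)))
  constructor
  · rintro ⟨-, w, -, hw⟩
    -- Squaring the formula for `w` eliminates the root and leaves the denominator times the
    -- quadratic equation. As the denominator series has X²-coefficient 1, it can be cancelled.
    have hz := (hD.mul hQ).eq_zero_of_frequently (by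
      refine (frequently_im_inv_pos.and_eventually self_mem_nhdsWithin).mono ?_
      rintro x ⟨hx, hx0⟩
      have hx0 : x ≠ 0 := hx0
      obtain ⟨h1, h2, -⟩ := hw _ hx
      rw [cauchyTransform_inv hx0] at h2
      have h3 : w x⁻¹ = (1 + 2 * b) * x⁻¹ + a -
        2 * (b * x⁻¹ ^ 2 + a * x⁻¹ + 1) * (x * g x) := by rw [h2]; ring
      rw [h3] at h1
      have hxi : x * x⁻¹ = 1 := mul_inv_cancel₀ hx0
      field_simp at h1
      linear_combination (1 / 4) * h1)
    refine (mul_eq_zero.1 hz).resolve_left fun h => ?_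
    have := congrArg (PowerSeries.coeff 2) h
    simp [← pow_two, PowerSeries.coeff_X_pow] at this
  · intro h0
    have hev := hQ.eventually_eq_zero h0
    set G := cauchyTransform μ with hG
    have hGd := differentiableOn_cauchyTransform hμ
    have hopen : IsOpen {z : ℂ | 0 < z.im} := isOpen_lt continuous_const Complex.continuous_im
    set Q : ℂ → ℂ := fun z => (b * z ^ 2 + a * z + 1) * G z ^ 2 - ((1 + 2 * b) * z + a) * G z +
      (1 + b) with hQdef
    have hQd : DifferentiableOn ℂ Q {z | 0 < z.im} := by
      have hp1 : DifferentiableOn ℂ (fun z : ℂ => (b : ℂ) * z ^ 2 + a * z + 1) {z | 0 < z.im} := by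
        fun_prop
      have hp2 : DifferentiableOn ℂ (fun z : ℂ => (1 + 2 * (b : ℂ)) * z + a) {z | 0 < z.im} := by
        fun_prop
      exact ((hp1.mul (hGd.pow 2)).sub (hp2.mul hGd)).add_const _
    -- The series identity makes `Q` vanish near a point of the imaginary axis far from the origin;
    -- the identity theorem extends this to the half plane.
    have hQ0 : Set.EqOn Q 0 {z | 0 < z.im} := by
      have hconn : IsPreconnected {z : ℂ | 0 < z.im} := (convex_halfSpace_im_gt 0).isPreconnected
      have hinv : Tendsto (fun e : ℝ => (Complex.I * (e : ℂ))⁻¹) atTop (𝓝 0) := by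
        refine tendsto_inv₀_cobounded.comp ?_
        rw [← tendsto_norm_atTop_iff_cobounded]
        refine tendsto_abs_atTop_atTop.congr fun e => ?_
        simp
      obtain ⟨e, he, he0⟩ :=
        ((hinv.eventually hev.eventually_nhds).and (eventually_gt_atTop 0)).exists
      have hz0 : (Complex.I * (e : ℂ)) ≠ 0 := by simp [he0.ne']
      have hz : 0 < (Complex.I * (e : ℂ)).im := by simpa using he0
      refine (hQd.analyticOnNhd hopen).eqOn_zero_of_preconnected_of_eventuallyEq_zero hconn hz ?_
      have hc : Tendsto (fun z : ℂ => z⁻¹) (𝓝 (Complex.I * (e : ℂ)))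
        (𝓝 (Complex.I * (e : ℂ))⁻¹) := tendsto_inv₀ hz0
      filter_upwards [hc.eventually he, eventually_ne_nhds hz0] with z hz hz0
      have hGz : G z = z⁻¹ * g z⁻¹ := by
        rw [hG, hg, ← cauchyTransform_inv (inv_ne_zero hz0), inv_inv]
      simp only [hQdef, hGz, Pi.zero_apply]
      field_simp at hz ⊢
      linear_combination hz
    -- The branch `w` is read off from the formula for G; completing the square in `Q` gives w².
    refine ⟨hμ, fun z => (1 + 2 * b) * z + a - 2 * (b * z ^ 2 + a * z + 1) * G z, ?_, ?_⟩
    · have hp1 : DifferentiableOn ℂ (fun z : ℂ => 2 * ((b : ℂ) * z ^ 2 + a * z + 1))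
          {z | 0 < z.im} := by fun_prop
      have hp2 : DifferentiableOn ℂ (fun z : ℂ => (1 + 2 * (b : ℂ)) * z + a) {z | 0 < z.im} := by
        fun_prop
      exact hp2.sub (hp1.mul hGd)
    · intro z hz
      refine ⟨?_, by ring, cauchyTransform_im_nonpos hμ hz⟩
      have := hQ0 hz
      simp only [hQdef, Pi.zero_apply] at this
      linear_combination 4 * (b * z ^ 2 + a * z + 1) * this

open PowerSeries in
/-- Scaling of the variance to one. -/
theorem isMeixnerSeries_rescale {a b s u : ℂ} (hu : u ≠ 0) (hs : u ^ 2 = s) {m : ℕ → ℂ} :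
    IsMeixnerSeries (a / u) (b / s) 1 (PowerSeries.mk fun n => u⁻¹ ^ n * m n) ↔
      IsMeixnerSeries a b s (PowerSeries.mk m) := by
  have hs0 : s ≠ 0 := hs ▸ pow_ne_zero 2 hu
  have hinj : Function.Injective (rescale u⁻¹) := by
    intro p q h
    have := congrArg (rescale u) h
    simpa [rescale_rescale, hu] using this
  have hCs : (C s : PowerSeries ℂ) ≠ 0 := fun h => hs0 (by
    have := congrArg constantCoeff h
    simpa using this)
  have e1 : C s * C (b / s) = (C b : PowerSeries ℂ) := by
    rw [← map_mul, mul_div_cancel₀ _ hs0]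
  have e2 : C s * C (a / u) = C a * C s * (C u⁻¹ : PowerSeries ℂ) := by
    simp only [← map_mul]
    congr 1
    field_simp
  have e3 : C s ^ 2 * C u⁻¹ ^ 2 = (C s : PowerSeries ℂ) := by
    simp only [← map_mul, ← map_pow]
    congr 1
    rw [inv_pow, hs]
    field_simp
  have e4 : ∀ x : ℂ, rescale u⁻¹ (C x) = C x := fun x => by
    ext n
    rw [coeff_rescale, coeff_C]
    split_ifs with h <;> simp [h]
  rw [← rescale_mk, IsMeixnerSeries, IsMeixnerSeries, ← mul_right_inj' hCs]
  refine Iff.trans ?_ hinj.eq_iff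
  simp only [map_add, map_mul, map_sub, map_pow, map_one, rescale_X, e4]
  set N := rescale u⁻¹ (PowerSeries.mk m)
  constructor
  · intro h
    linear_combination h - (N - 1) ^ 2 * e1 - X * N * (N - 1) * e2 + X ^ 2 * N ^ 2 * e3
  · intro h
    linear_combination h + (N - 1) ^ 2 * e1 + X * N * (N - 1) * e2 - X ^ 2 * N ^ 2 * e3

end CauchyTransform

/-! ### Normal functionals are determined by powers of the generator. -/

section Density

variable {H : Type*} [NormedAddCommGroup H] [InnerProductSpace ℂ H]

/-- The operator that acts by `T` on each coordinate of a square-summable sequence. -/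
noncomputable def amplification (T : H →L[ℂ] H) :
    lp (fun _ : ℕ => H) 2 →L[ℂ] lp (fun _ : ℕ => H) 2 :=
  lp.mapCLM 2 (fun _ => T) (norm_nonneg T) (fun _ => le_rfl)

theorem amplification_apply (T : H →L[ℂ] H) (v : lp (fun _ : ℕ => H) 2) (n : ℕ) :
    amplification T v n = T (v n) := rfl

theorem amplification_single (T : H →L[ℂ] H) (n : ℕ) (h : H) :
    amplification T (lp.single 2 n h) = lp.single 2 n (T h) := by
  ext m
  rw [amplification_apply, lp.single_apply, lp.single_apply]
  by_cases hm : m = n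
  · subst hm; simp
  · simp [Pi.single_eq_of_ne hm]

variable [CompleteSpace H]

theorem inner_amplification_left {S : H →L[ℂ] H} (hS : IsSelfAdjoint S)
    (v w : lp (fun _ : ℕ => H) 2) :
    ⟪amplification S v, w⟫_ℂ = ⟪v, amplification S w⟫_ℂ := by
  rw [lp.inner_eq_tsum, lp.inner_eq_tsum]
  refine tsum_congr fun n => ?_
  rw [amplification_apply, amplification_apply, ← ContinuousLinearMap.adjoint_inner_right]
  rw [← ContinuousLinearMap.star_eq_adjoint, hS.star_eq]

/-- A normal functional that vanishes on the powers of a self-adjoint operator vanishes on the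
bicommutant of the operator. -/
theorem tsum_inner_eq_zero_of_forall_pow {S Y : H →L[ℂ] H} (hS : IsSelfAdjoint S)
    (hY : ∀ T : H →L[ℂ] H, S * T = T * S → Y * T = T * Y) (ξ η : lp (fun _ : ℕ => H) 2)
    (h : ∀ k : ℕ, ∑' n, ⟪ξ n, (S ^ k) (η n)⟫_ℂ = 0) :
    ∑' n, ⟪ξ n, Y (η n)⟫_ℂ = 0 := by
  set A := amplification S with hA
  have hpow : ∀ k v, (∀ n, ((A ^ k) v : lp (fun _ : ℕ => H) 2) n = (S ^ k) (v n)) := by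
    intro k
    induction k with
    | zero => intro v n; simp
    | succ k ih =>
      intro v n
      rw [pow_succ, pow_succ, mul_apply_eq_comp, mul_apply_eq_comp, ih, hA,
        amplification_apply]
  -- As in the bicommutant theorem: the projection onto the closed cyclic subspace of `η` commutes
  -- with the amplified `S`, hence with the amplified `Y`. So `Y η` lies in this subspace, to which
  -- `ξ` is orthogonal by hypothesis.
  set K₀ : Submodule ℂ (lp (fun _ : ℕ => H) 2) :=
    Submodule.span ℂ (Set.range fun k : ℕ => (A ^ k) η) with hK₀
  set K := K₀.topologicalClosure with hK
  have hKc : IsClosed (K : Set (lp (fun _ : ℕ => H) 2)) := K₀.isClosed_topologicalClosure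
  have : CompleteSpace K := hKc.completeSpace_coe
  have hAK₀ : ∀ v ∈ K₀, A v ∈ K₀ := by
    intro v hv
    induction hv using Submodule.span_induction with
    | mem v hv =>
      obtain ⟨k, rfl⟩ := hv
      refine Submodule.subset_span ⟨k + 1, ?_⟩
      simp only [pow_succ', mul_apply_eq_comp]
    | zero => simp
    | add v w _ _ hv hw => rw [map_add]; exact K₀.add_mem hv hw
    | smul a v _ hv => rw [map_smul]; exact K₀.smul_mem a hv
  have hAK : ∀ v ∈ K, A v ∈ K := by
    intro v hv
    exact map_mem_closure A.continuous hv hAK₀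
  have hAKo : ∀ v ∈ Kᗮ, A v ∈ Kᗮ := by
    intro v hv w hw
    rw [← inner_amplification_left hS]
    exact hv _ (hAK w hw)
  have hPA : ∀ v, K.starProjection (A v) = A (K.starProjection v) := by
    intro v
    refine Submodule.eq_starProjection_of_mem_orthogonal
      (hAK _ (Submodule.starProjection_apply_mem K v)) ?_
    rw [← map_sub]
    exact hAKo _ (Submodule.sub_starProjection_mem_orthogonal v)
  have hPY : ∀ v, K.starProjection (amplification Y v) = amplification Y (K.starProjection v) := by
    have heq : K.starProjection ∘L amplification Y = amplification Y ∘L K.starProjection := by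
      refine lp.ext_continuousLinearMap (by simp) fun n => ?_
      ext x m
      -- A matrix entry of the projection. It commutes with `S`, so `hY` applies to it.
      let T : H →L[ℂ] H := (lp.evalCLM ℂ (fun _ : ℕ => H) 2 m) ∘L K.starProjection ∘L
        lp.singleContinuousLinearMap ℂ (fun _ : ℕ => H) 2 n
      have hT : ∀ x, T x = K.starProjection (lp.single 2 n x) m := fun x => rfl
      have hcomm : S * T = T * S := by
        ext x
        rw [mul_apply_eq_comp, mul_apply_eq_comp, hT, hT,
          ← amplification_single, ← hA, hPA, hA, amplification_apply]
      have := congrArg (fun U : H →L[ℂ] H => U x) (hY T hcomm)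
      simp only [mul_apply_eq_comp, hT] at this
      simp only [ContinuousLinearMap.comp_apply, lp.singleContinuousLinearMap_apply,
        amplification_apply, amplification_single]
      exact this.symm
    exact fun v => congrArg (fun U => U v) heq
  have hη : η ∈ K := K₀.le_topologicalClosure (Submodule.subset_span ⟨0, by simp⟩)
  have hYη : amplification Y η ∈ K := by
    have := hPY η
    rw [Submodule.starProjection_eq_self_iff.2 hη] at this
    exact Submodule.starProjection_eq_self_iff.1 this
  have hξ : ∀ v ∈ K, ⟪ξ, v⟫_ℂ = 0 := by
    intro v hv
    have hcl : IsClosed {v : lp (fun _ : ℕ => H) 2 | ⟪ξ, v⟫_ℂ = 0} :=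
      isClosed_eq (by fun_prop) continuous_const
    have hK₀0 : ∀ v ∈ K₀, ⟪ξ, v⟫_ℂ = 0 := by
      intro v hv
      induction hv using Submodule.span_induction with
      | mem v hv =>
        obtain ⟨k, rfl⟩ := hv
        rw [lp.inner_eq_tsum, ← h k]
        exact tsum_congr fun n => by rw [hpow]
      | zero => simp
      | add v w _ _ hv hw => rw [inner_add_right, hv, hw, add_zero]
      | smul a v _ hv => rw [inner_smul_right, hv, mul_zero]
    exact hcl.closure_subset_iff.2 hK₀0 hv
  have := hξ _ hYη
  rwa [lp.inner_eq_tsum] at this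

theorem commute_of_mem_vonNeumannGenerated {S Y T : H →L[ℂ] H} (hS : IsSelfAdjoint S)
    (hY : Y ∈ vonNeumannGenerated {S}) (hT : S * T = T * S) : Y * T = T * Y := by
  have h : Y ∈ Set.centralizer (({S} ∪ star {S} : Set (H →L[ℂ] H)).centralizer) := by
    have : (vonNeumannGenerated {S} : Set (H →L[ℂ] H)) = _ :=
      StarSubalgebra.coe_centralizer_centralizer ℂ {S}
    rw [← this]
    exact hY
  refine (h T ?_).symm
  intro U hU
  have : U = S := by
    rcases hU with hU | hU
    · exact hU
    · have : star U = S := hU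
      rw [← star_star U, this, hS.star_eq]
  rw [this]
  exact hT

variable {M : VonNeumannAlgebra H} {τ : M.toStarSubalgebra →ₗ[ℂ] ℂ}

/-- The conditional expectation given a self-adjoint element is determined by the powers of this
element. -/
theorem isCondExpGiven_iff (hτ : IsNormalFaithfulTracialState M τ) {U V W : M.toStarSubalgebra}
    (hV : IsSelfAdjoint V) (hW : (W : H →L[ℂ] H) ∈ vonNeumannGenerated {(V : H →L[ℂ] H)}) :
    IsCondExpGiven τ U V W ↔ ∀ n : ℕ, τ (U * V ^ n) = τ (W * V ^ n) := by
  have hVmem : (V : H →L[ℂ] H) ∈ vonNeumannGenerated {(V : H →L[ℂ] H)} :=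
    subset_vonNeumannGenerated _ rfl
  constructor
  · intro h n
    exact h.2 _ (by
      change (((V ^ n : M.toStarSubalgebra)) : H →L[ℂ] H) ∈ _
      rw [SubmonoidClass.coe_pow]
      exact pow_mem hVmem n)
  · intro h
    refine ⟨hW, fun Y hY => ?_⟩
    have hVs : IsSelfAdjoint (V : H →L[ℂ] H) := by
      have := congrArg (Subtype.val) hV.star_eq
      exact this
    rw [← sub_eq_zero, ← map_sub, ← sub_mul]
    obtain ⟨ξ, η, hξ, hη, hsum⟩ := hτ.normal
    set D : H →L[ℂ] H := ((U - W : M.toStarSubalgebra) : H →L[ℂ] H) with hD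
    have hmem : ∀ f : ℕ → H, Summable (fun n => ‖f n‖ ^ 2) → Memℓp f 2 := by
      intro f hf
      refine memℓp_gen ?_
      simpa using hf
    let ξ' : lp (fun _ : ℕ => H) 2 := ⟨ξ, hmem ξ hξ⟩
    let η' : lp (fun _ : ℕ => H) 2 := ⟨η, hmem η hη⟩
    -- Moving `D` to the left vectors keeps them square-summable, so this functional of `Z` is
    -- normal as well.
    have hval : ∀ Z : M.toStarSubalgebra, τ ((U - W) * Z) =
        ∑' n, ⟪amplification (ContinuousLinearMap.adjoint D) ξ' n, (Z : H →L[ℂ] H) (η' n)⟫_ℂ := by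
      intro Z
      rw [← (hsum ((U - W) * Z)).tsum_eq]
      refine tsum_congr fun n => ?_
      rw [amplification_apply, ContinuousLinearMap.adjoint_inner_left]
      rfl
    rw [hval]
    refine tsum_inner_eq_zero_of_forall_pow hVs
      (fun T hT => commute_of_mem_vonNeumannGenerated hVs hY hT) _ _ fun k => ?_
    have := hval (V ^ k)
    rw [SubmonoidClass.coe_pow] at this
    rw [← this, sub_mul, map_sub, h k, sub_self]

end Density

/-! ### Existence of the law of a self-adjoint element. -/

section SpectralMeasure

open MeasureTheory

variable {H : Type*} [NormedAddCommGroup H] [InnerProductSpace ℂ H] [CompleteSpace H]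
  {M : VonNeumannAlgebra H} {τ : M.toStarSubalgebra →ₗ[ℂ] ℂ}

/-- Whatever commutes with `M` commutes with `x`, hence with f(x); the double commutant of `M` is
`M`. -/
theorem VonNeumannAlgebra.cfcHom_mem {x : H →L[ℂ] H} (hx : IsSelfAdjoint x) (hxM : x ∈ M)
    (f : C(spectrum ℝ x, ℝ)) : cfcHom hx f ∈ M.toStarSubalgebra := by
  have h : cfcHom hx f ∈ Set.centralizer (Set.centralizer (M : Set (H →L[ℂ] H))) := by
    intro y hy
    exact (hx.commute_cfcHom hx (hy x hxM) f).symm.eq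
  rw [M.centralizer_centralizer] at h
  exact h

/-- By polarization, 4y = (1 + y)² - (1 - y)², and τ is nonnegative on both squares. -/
theorem IsNormalFaithfulTracialState.im_eq_zero (hτ : IsNormalFaithfulTracialState M τ)
    {y : M.toStarSubalgebra} (hy : IsSelfAdjoint y) : (τ y).im = 0 := by
  have h1 := (Complex.nonneg_iff.1 (hτ.nonneg (1 + y))).2
  have h2 := (Complex.nonneg_iff.1 (hτ.nonneg (1 - y))).2
  rw [star_add, star_one, hy.star_eq] at h1
  rw [star_sub, star_one, hy.star_eq] at h2
  have e : (4 : ℂ) * τ y = τ ((1 + y) * (1 + y)) - τ ((1 - y) * (1 - y)) := by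
    rw [← map_sub, show (1 + y) * (1 + y) - (1 - y) * (1 - y) = y + y + y + y by noncomm_ring]
    simp only [map_add]
    ring
  have := congrArg Complex.im e
  rw [Complex.sub_im, ← h1, ← h2] at this
  simpa using this

/-- The spectral distribution of a self-adjoint element. -/
theorem IsNormalFaithfulTracialState.exists_isLawOf (hτ : IsNormalFaithfulTracialState M τ)
    {x : M.toStarSubalgebra} (hx : IsSelfAdjoint x) : ∃ μ : Measure ℝ, IsLawOf τ x μ := by
  have hxs : IsSelfAdjoint (x : H →L[ℂ] H) := congrArg Subtype.val hx.star_eq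
  let φ : C(spectrum ℝ (x : H →L[ℂ] H), ℝ) → M.toStarSubalgebra := fun f =>
    ⟨cfcHom hxs f, VonNeumannAlgebra.cfcHom_mem hxs x.2 f⟩
  have hadd : ∀ f g, φ (f + g) = φ f + φ g := fun f g => Subtype.ext (map_add (cfcHom hxs) f g)
  have hsmul : ∀ (r : ℝ) f, φ (r • f) = (r : ℂ) • φ f := fun r f => Subtype.ext (by
    change cfcHom hxs (r • f) = (r : ℂ) • cfcHom hxs f
    rw [map_smul, Complex.coe_smul])
  have hpos : ∀ f, 0 ≤ f → 0 ≤ (τ (φ f)).re := by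
    intro f hf
    let g : C(spectrum ℝ (x : H →L[ℂ] H), ℝ) := ⟨fun y => √(f y), by fun_prop⟩
    have hfg : f = g * star g := by
      ext y
      exact (Real.mul_self_sqrt (hf y)).symm
    have : φ f = φ g * star (φ g) := Subtype.ext (by
      change cfcHom hxs f = cfcHom hxs g * star (cfcHom hxs g)
      rw [← map_star, ← map_mul, ← hfg])
    rw [this]
    exact (Complex.nonneg_iff.1 (hτ.nonneg (φ g))).1
  have : CompactSpace (spectrum ℝ (x : H →L[ℂ] H)) :=
    isCompact_iff_compactSpace.1 (spectrum.isCompact _)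
  -- The law comes from the Riesz representation of f ↦ Re τ(f(x)) on the compact spectrum, pushed
  -- forward to ℝ.
  let L : CompactlySupportedContinuousMap (spectrum ℝ (x : H →L[ℂ] H)) ℝ →ₚ[ℝ] ℝ :=
    PositiveLinearMap.mk₀
      { toFun := fun f => (τ (φ f.toContinuousMap)).re
        map_add' := fun f g => by
          have : (f + g).toContinuousMap = f.toContinuousMap + g.toContinuousMap := rfl
          rw [this, hadd, map_add, Complex.add_re]
        map_smul' := fun r f => by
          have : (r • f).toContinuousMap = r • f.toContinuousMap := rfl
          rw [this, hsmul, map_smul, smul_eq_mul, Complex.re_ofReal_mul]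
          rfl }
      (fun f hf => hpos _ hf)
  set ν := RealRMK.rieszMeasure L with hν
  have hint : ∀ f : C(spectrum ℝ (x : H →L[ℂ] H), ℝ), ∫ y, f y ∂ν = (τ (φ f)).re := fun f =>
    RealRMK.integral_rieszMeasure L ⟨f, HasCompactSupport.of_compactSpace _⟩
  have hpow : ∀ n : ℕ, ∫ y, (y : ℝ) ^ n ∂ν = (τ (x ^ n)).re := by
    intro n
    have h := hint (((ContinuousMap.id ℝ).restrict (spectrum ℝ (x : H →L[ℂ] H))) ^ n)
    have hφ : φ (((ContinuousMap.id ℝ).restrict (spectrum ℝ (x : H →L[ℂ] H))) ^ n) = x ^ n :=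
      Subtype.ext (by
        change cfcHom hxs _ = _
        rw [map_pow, cfcHom_id hxs, SubmonoidClass.coe_pow])
    rw [hφ] at h
    exact h
  have hfin : IsFiniteMeasure ν := inferInstance
  have hprob : IsProbabilityMeasure ν := by
    have h := hpow 0
    simp only [pow_zero, hτ.map_one, Complex.one_re, integral_const, smul_eq_mul, mul_one] at h
    refine ⟨?_⟩
    rw [Measure.real, ENNReal.toReal_eq_one_iff] at h
    exact h
  refine ⟨ν.map Subtype.val, ⟨Measure.isProbabilityMeasure_map (by fun_prop), ?_⟩, ?_⟩
  · obtain ⟨r, hr⟩ := (spectrum.isCompact (𝕜 := ℝ) (x : H →L[ℂ] H)).isBounded.subset_closedBall 0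
    refine ⟨r, ?_⟩
    rw [Measure.map_apply (by fun_prop) measurableSet_Icc.compl]
    convert measure_empty (μ := ν)
    ext y
    have := hr y.2
    rw [Real.closedBall_eq_Icc, zero_sub, zero_add] at this
    simpa using this
  · intro n
    rw [integral_map (by fun_prop) (by fun_prop), hpow n]
    refine Complex.ext (by simp) ?_
    rw [Complex.ofReal_im]
    exact hτ.im_eq_zero (hx.pow n)

end SpectralMeasure

/-! ### Cumulants of a free Lévy process. -/

section FreeLevyProcess

variable {A : Type*} [Ring A] [Algebra ℂ A] {τ : A →ₗ[ℂ] ℂ}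

theorem freeCumulant_one_const {x : A} (h1 : τ 1 = 1) :
    freeCumulant τ 1 (fun _ => x) = τ x := by
  have h := moment_pow_eq_ncMoment h1 x 1
  rw [pow_one, ncMoment_succ, coeff_zero_ncWeight] at h
  exact h.symm

theorem freeCumulant_two_const {x : A} (h1 : τ 1 = 1) (hx : τ x = 0) :
    freeCumulant τ 2 (fun _ => x) = τ (x ^ 2) := by
  have h := moment_pow_eq_ncMoment h1 x 2
  rw [ncMoment_succ, ncWeight_eq, Finset.sum_range_one, ncMoment_zero, coeff_zero_ncWeight,
    freeCumulant_one_const h1, hx, zero_mul, zero_add, one_mul] at h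
  exact h.symm

variable [StarRing A] {X : ℝ≥0 → A}

/-- The increments over `[0, t]` and `[t, s]`. -/
theorem IsFreeLevyProcess.freelyIndependent_pair (hX : IsFreeLevyProcess τ X) {t s : ℝ≥0}
    (ht : 0 < t) (hts : t < s) : FreelyIndependent τ ![X t, X s - X t] := by
  have hmono : StrictMono ![0, t, s] := by
    rw [Fin.strictMono_iff_lt_succ]
    intro i
    fin_cases i
    · simpa using ht
    · simpa using hts
  have h := hX.free_increments 2 ![0, t, s] hmono
  have e : (fun i : Fin 2 => X (![0, t, s] i.succ) - X (![0, t, s] i.castSucc)) =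
      ![X t, X s - X t] := by
    funext i
    fin_cases i
    · simp [hX.zero]
    · simp
  rwa [e] at h

theorem IsFreeLevyProcess.sameDistribution_increment (hX : IsFreeLevyProcess τ X) (t s : ℝ≥0) :
    SameDistribution τ (X (t + s) - X t) (X s) := by
  have h := hX.stationary t 0 s
  rwa [zero_add, hX.zero, sub_zero] at h

/-- X_s is the sum of two free increments with the law of X_{s/2}, and cumulants of free elements
add. -/
theorem IsFreeLevyProcess.freeCumulant_half (hX : IsFreeLevyProcess τ X) {s : ℝ≥0} (hs : 0 < s)
    {k : ℕ} (hk : 0 < k) : freeCumulant τ k (fun _ => X (s / 2)) =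
      1 / 2 * freeCumulant τ k (fun _ => X s) := by
  have hfree := hX.freelyIndependent_pair (half_pos hs) (NNReal.half_lt_self hs.ne')
  have h := hfree.freeCumulant_word hk (fun _ => False)
  have hd := (hX.sameDistribution_increment (s / 2) (s / 2)).freeCumulant_eq k
  rw [add_halves] at hd
  simp only [if_false, exists_false, Matrix.cons_val_zero, Matrix.cons_val_one,
    add_sub_cancel, hd] at h
  rw [h]
  ring

end FreeLevyProcess

/-! ### Both conditions as the quadratic equation at a fixed time. -/

section MeixnerProcess

variable {H : Type*} [NormedAddCommGroup H] [InnerProductSpace ℂ H] [CompleteSpace H]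
  {M : VonNeumannAlgebra H} {τ : M.toStarSubalgebra →ₗ[ℂ] ℂ}

/-- The normalized increments have a free Meixner law if and only if the moment generating function
solves the quadratic equation. -/
theorem IsFreeLevyProcess.hasFreeMeixnerLaw_iff (hτ : IsNormalFaithfulTracialState M τ)
    {X : ℝ≥0 → M.toStarSubalgebra} (hX : IsFreeLevyProcess τ X) (a b : ℝ) (t : ℝ≥0) {s : ℝ≥0}
    (hs : 0 < s) :
    HasFreeMeixnerLaw τ ((((√(s : ℝ))⁻¹ : ℝ) : ℂ) • (X (t + s) - X t))
        (a / √(s : ℝ)) (b / (s : ℝ)) ↔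
      IsMeixnerSeries (a : ℂ) (b : ℂ) ((s : ℝ) : ℂ)
        (PowerSeries.mk (ncMoment fun k => freeCumulant τ k (fun _ => X s))) := by
  set Y := (((√(s : ℝ))⁻¹ : ℝ) : ℂ) • (X (t + s) - X t) with hY
  have hmom : ∀ n, τ (Y ^ n) = ((√(s : ℝ) : ℝ) : ℂ)⁻¹ ^ n *
      ncMoment (fun k => freeCumulant τ k (fun _ => X s)) n := by
    intro n
    rw [hY, smul_pow, map_smul, smul_eq_mul, hX.sameDistribution_increment t s n,
      moment_pow_eq_ncMoment hτ.map_one, Complex.ofReal_inv]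
  have hsqrt : ((√(s : ℝ) : ℝ) : ℂ) ≠ 0 :=
    Complex.ofReal_ne_zero.2 (Real.sqrt_pos.2 (NNReal.coe_pos.2 hs)).ne'
  have hsq : ((√(s : ℝ) : ℝ) : ℂ) ^ 2 = ((s : ℝ) : ℂ) := by
    rw [← Complex.ofReal_pow, Real.sq_sqrt (NNReal.coe_nonneg s)]
  have key : ∀ μ, IsLawOf τ Y μ → (IsFreeMeixnerLaw (a / √(s : ℝ)) (b / (s : ℝ)) μ ↔
      IsMeixnerSeries (a : ℂ) (b : ℂ) ((s : ℝ) : ℂ)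
        (PowerSeries.mk (ncMoment fun k => freeCumulant τ k (fun _ => X s)))) := by
    rintro μ ⟨hμ, hμm⟩
    rw [isFreeMeixnerLaw_iff hμ, ← isMeixnerSeries_rescale hsqrt hsq]
    simp only [← hμm, hmom, Complex.ofReal_div]
  constructor
  · rintro ⟨μ, hμ, hmx⟩
    exact (key μ hμ).1 hmx
  · intro h
    have hYs : IsSelfAdjoint Y := by
      refine IsSelfAdjoint.smul ?_ ((hX.selfAdjoint _).sub (hX.selfAdjoint _))
      exact Complex.conj_ofReal _
    obtain ⟨μ, hμ⟩ := hτ.exists_isLawOf hYs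
    exact ⟨μ, hμ, (key μ hμ).2 h⟩

/-- The regression formula holds if and only if the moment generating function solves the quadratic
equation, provided that the cumulants at the times `t` and `s` are proportional. -/
theorem IsFreeLevyProcess.regression_iff (hτ : IsNormalFaithfulTracialState M τ)
    {X : ℝ≥0 → M.toStarSubalgebra} (hX : IsFreeLevyProcess τ X) {a b : ℝ} (hb : 0 ≤ b)
    {t s : ℝ≥0} (ht : 0 < t) (hts : t < s) (hmean : τ (X s) = 0)
    (hvar : τ (X s ^ 2) = ((s : ℝ) : ℂ))
    (hl : ∀ k, 0 < k → freeCumulant τ k (fun _ => X t) =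
      (((t : ℝ) / s : ℝ) : ℂ) * freeCumulant τ k (fun _ => X s)) :
    IsCondExpGiven τ (X t * X s * X t) (X s)
        (((((s : ℝ) - t) * t / ((s : ℝ) ^ 2 * (b + s) ^ 2) : ℝ) : ℂ) •
            (((b ^ 2 : ℝ) : ℂ) • X s ^ 3 + ((2 * b * a * s : ℝ) : ℂ) • X s ^ 2
              + (((b + a ^ 2) * (s : ℝ) ^ 2 : ℝ) : ℂ) • X s
              + ((a * (s : ℝ) ^ 3 : ℝ) : ℂ) • (1 : M.toStarSubalgebra))
          + (((t : ℝ) ^ 2 / (s : ℝ) ^ 2 : ℝ) : ℂ) • X s ^ 3) ↔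
      IsMeixnerSeries (a : ℂ) (b : ℂ) ((s : ℝ) : ℂ)
        (PowerSeries.mk (ncMoment fun k => freeCumulant τ k (fun _ => X s))) := by
  have hs : 0 < s := ht.trans hts
  have hsR : (0 : ℝ) < s := NNReal.coe_pos.2 hs
  have htR : (0 : ℝ) < t := NNReal.coe_pos.2 ht
  have htsR : (t : ℝ) < s := NNReal.coe_lt_coe.2 hts
  have hc1 : freeCumulant τ 1 (fun _ => X s) = 0 := by
    rw [freeCumulant_one_const hτ.map_one, hmean]
  have hc2 : freeCumulant τ 2 (fun _ => X s) = ((s : ℝ) : ℂ) := by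
    rw [freeCumulant_two_const hτ.map_one hmean, hvar]
  -- Here `0 ≤ b` enters, and again below for b + s ≠ 0.
  have hbs : 2 * (b : ℂ) + ((s : ℝ) : ℂ) ≠ 0 := by
    have : (2 * b + s : ℝ) ≠ 0 := by positivity
    exact_mod_cast this
  rw [isCondExpGiven_iff hτ (hX.selfAdjoint s), ← ncWeight_three_iff_isMeixnerSeries
    (c := fun k => freeCumulant τ k (fun _ => X s)) hc1 hc2 hbs]
  swap
  · have hmem : ((X s : M.toStarSubalgebra) : H →L[ℂ] H) ∈
        (vonNeumannGenerated {((X s : M.toStarSubalgebra) : H →L[ℂ] H)}).toStarSubalgebra :=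
      subset_vonNeumannGenerated _ rfl
    exact add_mem (S := StarSubalgebra ℂ (H →L[ℂ] H))
      (SMulMemClass.smul_mem _ (add_mem (add_mem (add_mem
      (SMulMemClass.smul_mem _ (pow_mem hmem 3)) (SMulMemClass.smul_mem _ (pow_mem hmem 2)))
      (SMulMemClass.smul_mem _ hmem)) (SMulMemClass.smul_mem _ (one_mem _))))
      (SMulMemClass.smul_mem _ (pow_mem hmem 3))
  refine forall_congr' fun n => ?_
  have hfree := hX.freelyIndependent_pair ht hts
  have htriple := hfree.moment_triple (l := (((t : ℝ) / s : ℝ) : ℂ))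
    (by simpa using hl) (by simpa using hc1) n
  simp only [Matrix.cons_val_zero, Matrix.cons_val_one, add_sub_cancel] at htriple
  rw [htriple]
  simp only [add_mul, smul_mul_assoc, ← pow_add, ← pow_succ', one_mul, map_add, map_smul,
    smul_eq_mul, moment_pow_eq_ncMoment hτ.map_one]
  rw [add_comm 3 n, add_comm 2 n]
  set c : ℕ → ℂ := fun k => freeCumulant τ k (fun _ => X s)
  have hbsC : (b : ℂ) + ((s : ℝ) : ℂ) ≠ 0 := by
    have : (b + s : ℝ) ≠ 0 := by positivity
    exact_mod_cast this
  have hsC : ((s : ℝ) : ℂ) ≠ 0 := Complex.ofReal_ne_zero.2 hsR.ne'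
  have htC : ((t : ℝ) : ℂ) ≠ 0 := Complex.ofReal_ne_zero.2 htR.ne'
  have hstC : ((s : ℝ) : ℂ) - ((t : ℝ) : ℂ) ≠ 0 := by
    have : ((s : ℝ) - t : ℝ) ≠ 0 := (sub_pos.2 htsR).ne'
    exact_mod_cast this
  push_cast
  generalize ((s : ℝ) : ℂ) = S at *
  generalize ((t : ℝ) : ℂ) = T at *
  -- With l = T/S the term l² m_{n+3} cancels against the last term of the regression formula. What
  -- remains is the relation for `ncWeight c 3 n` times this factor, as l(1 - l) = T(S - T)/S².
  have hk : T * (S - T) / (S ^ 2 * (b + S) ^ 2) ≠ 0 :=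
    div_ne_zero (mul_ne_zero htC hstC) (mul_ne_zero (pow_ne_zero _ hsC) (pow_ne_zero _ hbsC))
  refine sub_eq_zero.symm.trans
    ((Eq.congr ?_ rfl).trans (sub_eq_zero.trans (mul_right_inj' hk)))
  field_simp
  ring

end MeixnerProcess

/-! ### The equivalence. -/

theorem proposition3p4 {H : Type*} [NormedAddCommGroup H] [InnerProductSpace ℂ H]
    [CompleteSpace H] (M : VonNeumannAlgebra H) (τ : M.toStarSubalgebra →ₗ[ℂ] ℂ)
    (hτ : IsNormalFaithfulTracialState M τ)
    (X : ℝ≥0 → M.toStarSubalgebra) (hX : IsFreeLevyProcess τ X)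
    (hmean : ∀ t : ℝ≥0, 0 < t → τ (X t) = 0)
    (hvar : ∀ t : ℝ≥0, 0 < t → τ (X t ^ 2) = ((t : ℝ) : ℂ))
    (a b : ℝ) (hb : 0 ≤ b) :
    (∀ t s : ℝ≥0, 0 < t → 0 < s →
      HasFreeMeixnerLaw τ ((((√(s : ℝ))⁻¹ : ℝ) : ℂ) • (X (t + s) - X t))
        (a / √(s : ℝ)) (b / (s : ℝ))) ↔
    (∀ t s : ℝ≥0, t < s →
      IsCondExpGiven τ (X t * X s * X t) (X s)
        (((((s : ℝ) - t) * t / ((s : ℝ) ^ 2 * (b + s) ^ 2) : ℝ) : ℂ) •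
            (((b ^ 2 : ℝ) : ℂ) • X s ^ 3 + ((2 * b * a * s : ℝ) : ℂ) • X s ^ 2
              + (((b + a ^ 2) * (s : ℝ) ^ 2 : ℝ) : ℂ) • X s
              + ((a * (s : ℝ) ^ 3 : ℝ) : ℂ) • (1 : M.toStarSubalgebra))
          + (((t : ℝ) ^ 2 / (s : ℝ) ^ 2 : ℝ) : ℂ) • X s ^ 3)) := by
  constructor
  · intro h t s hts
    have hs : 0 < s := pos_of_gt hts
    -- At t = 0 both sides of the regression formula vanish, while the cumulant argument needs t >
    -- 0.
    rcases eq_zero_or_pos t with rfl | ht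
    · have e : ((((s : ℝ) - ((0 : ℝ≥0) : ℝ)) * ((0 : ℝ≥0) : ℝ) / ((s : ℝ) ^ 2 * (b + s) ^ 2) : ℝ) : ℂ)
          = 0 := by simp
      have e' : ((((0 : ℝ≥0) : ℝ) ^ 2 / (s : ℝ) ^ 2 : ℝ) : ℂ) = 0 := by simp
      rw [e, e', zero_smul, zero_smul, add_zero, hX.zero, mul_zero]
      exact ⟨zero_mem _, fun _ _ => rfl⟩
    -- The starting time 1 is arbitrary: by stationarity only the length of the increment matters.
    have hmeix : ∀ r : ℝ≥0, 0 < r → IsMeixnerSeries (a : ℂ) (b : ℂ) ((r : ℝ) : ℂ)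
        (PowerSeries.mk (ncMoment fun k => freeCumulant τ k (fun _ => X r))) := fun r hr =>
      (hX.hasFreeMeixnerLaw_iff hτ a b 1 hr).1 (h 1 r one_pos hr)
    have hne : ∀ r : ℝ≥0, 0 < r → ((r : ℝ) : ℂ) ≠ 0 := fun r hr =>
      Complex.ofReal_ne_zero.2 (NNReal.coe_pos.2 hr).ne'
    have hc1 : ∀ r : ℝ≥0, 0 < r → freeCumulant τ 1 (fun _ => X r) = 0 := fun r hr => by
      rw [freeCumulant_one_const hτ.map_one, hmean r hr]
    have hc2 : ∀ r : ℝ≥0, 0 < r → freeCumulant τ 2 (fun _ => X r) = ((r : ℝ) : ℂ) := fun r hr => by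
      rw [freeCumulant_two_const hτ.map_one (hmean r hr), hvar r hr]
    refine (hX.regression_iff hτ hb ht hts (hmean s hs) (hvar s hs) fun k hk => ?_).2 (hmeix s hs)
    have hprop := IsMeixnerSeries.cumulants_proportional (hne t ht) (hne s hs) (hc1 t ht)
      (hc2 t ht) (hc1 s hs) (hc2 s hs) (hmeix t ht) (hmeix s hs) k hk
    rw [Complex.ofReal_div, div_mul_eq_mul_div, eq_div_iff (hne s hs), mul_comm, hprop]
  · intro h t s _ hs
    refine (hX.hasFreeMeixnerLaw_iff hτ a b t hs).2 ?_
    -- At the midpoint the cumulants are proportional with factor 1/2 for every free Lévy process,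
    -- so no information on the law is needed.
    have hhalf : s / 2 < s := NNReal.half_lt_self hs.ne'
    refine (hX.regression_iff hτ hb (half_pos hs) hhalf (hmean s hs) (hvar s hs)
      fun k hk => ?_).1 (h (s / 2) s hhalf)
    rw [hX.freeCumulant_half hs hk]
    have hsR : (s : ℝ) ≠ 0 := (NNReal.coe_pos.2 hs).ne'
    have : ((s / 2 : ℝ≥0) : ℝ) / (s : ℝ) = 1 / 2 := by
      rw [NNReal.coe_div, NNReal.coe_ofNat]
      field_simp
    rw [this]
    norm_num
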